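/- A projection game $(q, A, B, E, \{\pi_e\}_{e\in E})$ consists of a simple bipartite graph $(A,B,E)$ and, for each edge $e\in E$, a map $\pi_e:[q]\to[q]$, where $q\ge 1$. An assignment is a map $\varphi: A\cup B\to[q]$; it satisfies the edge $e=(a,b)$ if $\pi_e(\varphi(a))=\varphi(b)$, and its value is the fraction of the edges that it satisfies. The game is satisfiable if some assignment satisfies all edges. For even $n$, let $\mathcal G(n/2,n/2,p)$ be the random bipartite graph with $n/2$ vertices on each side in which each pair of a left and a right vertex is an edge with probability $p$, independently. For a game with $n$ vertices in total put $N=nq$. Theorem. For every constant $\gamma>0$ there is a deterministic algorithm that, on every projection game with $n/2$ vertices on each side, produces an assignment in time polynomial in $N$, and there are a constant $K>0$ and a function $\varepsilon(n)\to 0$ (as $n\to\infty$) such that the following holds for every even $n$ and every $p$ with $10\sqrt{\log n/n}\le p\le 1$: with probability at least $1-\varepsilon(n)$ over $(A,B,E)\sim\mathcal G(n/2,n/2,p)$, for every $q$ and every satisfiable projection game with alphabet $[q]$ on the graph $(A,B,E)$, the algorithm produces an assignment of value at least $K N^{-\gamma}$. -/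

import Mathlib

open MeasureTheory ProbabilityTheory Filter Topology

/-! ### Projection games -/

/-- A projection game with alphabet `[q]` (here `Fin q`) on a simple bipartite graph with vertex
sides `A` and `B`: the edge set, and a projection `π_e : [q] → [q]` for each edge `e`. -/
structure ProjectionGame (A B : Type) (q : ℕ) where
  edges : Set (A × B)
  proj : edges → Fin q → Fin q

/-- An assignment of letters to all vertices, on both sides. -/
abbrev Assignment (A B : Type) (q : ℕ) : Type := A ⊕ B → Fin q

namespace ProjectionGame

variable {A B : Type} {q : ℕ}

/-- The edges `e = (a, b)` satisfied by `φ`, i.e. with `π_e (φ a) = φ b`. -/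
def satisfied (G : ProjectionGame A B q) (φ : Assignment A B q) : Set (A × B) :=
  {e | ∃ he : e ∈ G.edges, G.proj ⟨e, he⟩ (φ (Sum.inl e.1)) = φ (Sum.inr e.2)}

/-- The value of an assignment: the fraction of the edges that it satisfies. -/
noncomputable def value (G : ProjectionGame A B q) (φ : Assignment A B q) : ℝ :=
  ((G.satisfied φ).ncard : ℝ) / (G.edges.ncard : ℝ)

/-- A game is satisfiable if some assignment satisfies all of its edges. -/
def Satisfiable (G : ProjectionGame A B q) : Prop :=
  ∃ φ : Assignment A B q, G.satisfied φ = G.edges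

open scoped Classical in
/-- The game with sides `Fin m`, `Fin m` written out as a list of natural numbers: the two sizes
`m` and `q`, the adjacency matrix of the graph in row-major order, and the table of all the values
`π_(a, b) σ` (ordered lexicographically by `(a, b, σ)`, with entries `0` at pairs that are not
edges). The list has `2 + m * m + m * m * q` entries. -/
noncomputable def encode {m q : ℕ} (G : ProjectionGame (Fin m) (Fin m) q) : List ℕ :=
  [m, q] ++
  List.ofFn (fun i : Fin (m * m) => if finProdFinEquiv.symm i ∈ G.edges then 1 else 0) ++
  List.ofFn (fun j : Fin (m * m * q) =>
    if h : finProdFinEquiv.symm (finProdFinEquiv.symm j).1 ∈ G.edges then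
      (G.proj ⟨_, h⟩ (finProdFinEquiv.symm j).2 : ℕ)
    else 0)

end ProjectionGame

/-! ### Random access machine with step count

Programs for a random access machine with registers and (infinite, zero-initialised) arrays that
hold natural numbers; every program mentions only finitely many registers and arrays. The
arithmetic operations are addition and truncated subtraction, and every operation (also a test or
an access to an array) costs one step. As there is no multiplication, the bit length of a number
grows by at most one per operation, so that polynomial time on this machine with unit costs is
polynomial time on Turing machines. -/

namespace RAM

/-- Expressions: constants, registers, sums, truncated differences, and array entries
(`get k e` is the entry of array `k` at the index given by `e`). -/
inductive Expr : Type
  | lit (c : ℕ)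
  | reg (i : ℕ)
  | add (e f : Expr)
  | sub (e f : Expr)
  | get (k : ℕ) (e : Expr)

/-- Programs. `set i e` writes to register `i`, `put k e f` writes the value of `f` to array `k`
at index `e`, and tests ask whether an expression is nonzero. -/
inductive Prog : Type
  | skip
  | set (i : ℕ) (e : Expr)
  | put (k : ℕ) (e f : Expr)
  | seq (c d : Prog)
  | ite (e : Expr) (c d : Prog)
  | while (e : Expr) (c : Prog)

/-- The state of the machine: contents of the registers and of the arrays. -/
structure State : Type where
  reg : ℕ → ℕ
  arr : ℕ → ℕ → ℕ

/-- The value of an expression. -/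
def Expr.eval (s : State) : Expr → ℕ
  | lit c => c
  | reg i => s.reg i
  | add e f => e.eval s + f.eval s
  | sub e f => e.eval s - f.eval s
  | get k e => s.arr k (e.eval s)

/-- The number of steps for the evaluation of an expression: one for each of its nodes. -/
def Expr.cost : Expr → ℕ
  | lit _ => 1
  | reg _ => 1
  | add e f => e.cost + f.cost + 1
  | sub e f => e.cost + f.cost + 1
  | get _ e => e.cost + 1

/-- The state after writing `v` to register `i`. -/
def State.setReg (s : State) (i v : ℕ) : State :=
  { s with reg := Function.update s.reg i v }

/-- The state after writing `v` to array `k` at index `x`. -/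
def State.setArr (s : State) (k x v : ℕ) : State :=
  { s with arr := Function.update s.arr k (Function.update (s.arr k) x v) }

/-- `Runs c s t s'`: the program `c`, started in the state `s`, halts after exactly `t` steps, in
the state `s'`. -/
inductive Runs : Prog → State → ℕ → State → Prop
  | skip (s : State) : Runs .skip s 1 s
  | set (s : State) (i : ℕ) (e : Expr) :
      Runs (.set i e) s (e.cost + 1) (s.setReg i (e.eval s))
  | put (s : State) (k : ℕ) (e f : Expr) :
      Runs (.put k e f) s (e.cost + f.cost + 1) (s.setArr k (e.eval s) (f.eval s))
  | seq {c d : Prog} {s s' s'' : State} {t t' : ℕ} :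
      Runs c s t s' → Runs d s' t' s'' → Runs (.seq c d) s (t + t') s''
  | ite_true {e : Expr} {c d : Prog} {s s' : State} {t : ℕ} :
      e.eval s ≠ 0 → Runs c s t s' → Runs (.ite e c d) s (e.cost + 1 + t) s'
  | ite_false {e : Expr} {c d : Prog} {s s' : State} {t : ℕ} :
      e.eval s = 0 → Runs d s t s' → Runs (.ite e c d) s (e.cost + 1 + t) s'
  | while_true {e : Expr} {c : Prog} {s s' s'' : State} {t t' : ℕ} :
      e.eval s ≠ 0 → Runs c s t s' → Runs (.while e c) s' t' s'' →
      Runs (.while e c) s (e.cost + 1 + t + t') s''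
  | while_false {e : Expr} {c : Prog} {s : State} :
      e.eval s = 0 → Runs (.while e c) s (e.cost + 1) s

/-- The initial state: the input stands in array `0`, everything else is `0`. -/
def init (input : List ℕ) : State where
  reg := fun _ => 0
  arr := fun k x => if k = 0 then input.getD x 0 else 0

end RAM

/-- A deterministic algorithm for projection games with `m` vertices on each side: it produces an
assignment for every such game with a nonempty alphabet. -/
abbrev ProjectionGameAlgorithm : Type :=
  ∀ (m q : ℕ) [NeZero q], ProjectionGame (Fin m) (Fin m) q → Assignment (Fin m) (Fin m) q

/-- The algorithm runs in polynomial time: one fixed program for the random access machine, given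
the written-out game in array `0`, always halts with the assignment (the letters of the left
vertices, then those of the right vertices) in array `1`, after a number of steps that is at most
polynomial in `N = n * q`, where `n = 2 * m` is the number of vertices. -/
def ProjectionGameAlgorithm.IsPolyTime (alg : ProjectionGameAlgorithm) : Prop :=
  ∃ (c : RAM.Prog) (T : Polynomial ℕ),
    ∀ (m q : ℕ) [NeZero q] (G : ProjectionGame (Fin m) (Fin m) q),
      ∃ (t : ℕ) (s : RAM.State),
        RAM.Runs c (RAM.init G.encode) t s ∧
        t ≤ T.eval (2 * m * q) ∧
        (∀ a : Fin m, s.arr 1 a = (alg m q G (Sum.inl a) : ℕ)) ∧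
        (∀ b : Fin m, s.arr 1 (m + b) = (alg m q G (Sum.inr b) : ℕ))

/-- The random bipartite graph `𝒢(m, m, p)`, as the law of its edge set: each pair of a left and a
right vertex is an edge with probability `p`, independently. -/
noncomputable def randomBipartite (m : ℕ) (p : unitInterval) : Measure (Set (Fin m × Fin m)) :=
  setBernoulli Set.univ p

/-! ### Random sets -/

section RandomSets

variable {ι κ : Type*}

/-! The algorithm guesses the letters of a constant number of left vertices, the seeds. A guess
leaves at each left vertex `a'` the candidates: the letters that agree with the guess on all common
neighbours of `a'` and a seed. Each right vertex takes the letter with the most weighted support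
among its neighbours' candidates. All guesses are tried, the one of largest total support is kept,
and each left vertex then takes its best reply.

Fix a satisfying assignment and guess its letters on a seed set `S`. The entropy, the sum of the
logarithms of the numbers of candidates, lies between `0` and `m log q`. Hence some `S` with at most
`k + 1` elements is such that no further seed `a` lowers it by more than `m (log q) / k`
(`exists_seed`). For such `S` the fraction of the candidates at `a'` that survive the seed `a`
averages at least `q ^ (-1/k)` over `a'`, by comparison of arithmetic and geometric means. Survivors
project correctly to every common neighbour `b` of `a` and `a'`, so this fraction is at most the
fraction of candidates at `a'` that are correct at `b`. With at least `c` common neighbours for all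
pairs and right degrees at most `D`, double counting gives `c m² q ^ (-1/k) / D` as a lower bound
for the sum over the edges of the correct fractions (`le_sum_candidateFraction`). Up to a factor `2`
from rounding, the algorithm satisfies that many edges (`sum_candidateFraction_le`), out of at most
`m D`.

In the random graph `c = p² m / 4` and `D = 4 p m` are admissible with high probability, so `c m /
(2 D²) = 1/128`, and `k ≥ 1/γ` suffices. For the running time, the algorithm is written with a fixed
number of nested bounded sums, which compile to the machine with polynomial cost. -/

lemma setBernoulli_univ_real_superset (p : unitInterval) (F : Finset ι) :
    (setBernoulli (Set.univ : Set ι) p).real {E | (F : Set ι) ⊆ E} = (p : ℝ) ^ F.card := by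
  classical
  rw [measureReal_def, setBernoulli_apply']
  have : ((fun p : ι → Prop ↦ {i | p i}) ⁻¹' {E | (F : Set ι) ⊆ E})
      = Set.pi (F : Set ι) (fun _ => {True}) := by
    ext f
    simp only [Set.mem_preimage, Set.mem_ofPred_eq, Set.mem_pi, Set.mem_singleton_iff, eq_iff_iff,
      iff_true]
    rfl
  rw [this, Measure.infinitePi_pi _ (by intros; exact MeasurableSet.of_discrete)]
  simp

open scoped Classical in
-- Expanding the product, each monomial is the indicator that a union of blocks lies in the random
-- set; disjointness makes the exponents of `p` add up, so the expectation factorizes.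
lemma integral_prod_one_add_indicator [Fintype ι] (p : unitInterval) (c : ℝ) (s : Finset κ)
    (F : κ → Finset ι) (hF : (s : Set κ).PairwiseDisjoint F) :
    ∫ E : Set ι, ∏ j ∈ s, (1 + c * if (F j : Set ι) ⊆ E then 1 else 0)
      ∂(setBernoulli Set.univ p) = ∏ j ∈ s, (1 + c * (p : ℝ) ^ (F j).card) := by
  simp only [Finset.prod_one_add]
  rw [integral_finsetSum _ (fun _ _ => Integrable.of_finite)]
  refine Finset.sum_congr rfl fun t ht => ?_
  rw [Finset.mem_powerset] at ht
  have h1 : ∀ E : Set ι, ∏ j ∈ t, (c * if (F j : Set ι) ⊆ E then (1 : ℝ) else 0)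
      = c ^ t.card * Set.indicator {E : Set ι | ((t.biUnion F : Finset ι) : Set ι) ⊆ E} 1 E := by
    intro E
    rw [Finset.prod_mul_distrib, Finset.prod_const, Finset.prod_ite_zero]
    simp [Set.indicator_apply]
  simp_rw [h1]
  rw [integral_const_mul, integral_indicator_one MeasurableSet.of_discrete,
    setBernoulli_univ_real_superset, Finset.card_biUnion (fun x hx y hy h => hF (ht hx) (ht hy) h),
    Finset.prod_mul_distrib, Finset.prod_const, Finset.prod_pow_eq_pow_sum]

open scoped Classical in
lemma prod_one_add_indicator (c : ℝ) (s : Finset κ) (F : κ → Finset ι) (E : Set ι) :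
    ∏ j ∈ s, (1 + c * if (F j : Set ι) ⊆ E then (1 : ℝ) else 0)
      = (1 + c) ^ (s.filter fun j => (F j : Set ι) ⊆ E).card := by
  rw [← Finset.prod_const, Finset.prod_filter]
  refine Finset.prod_congr rfl fun j _ => ?_
  split_ifs <;> simp

open scoped Classical in
/-- Upper tail for the number of blocks `F j` that a random set contains. -/
lemma setBernoulli_upper_tail [Fintype ι] (p : unitInterval) (s : Finset κ)
    (F : κ → Finset ι) (hF : (s : Set κ).PairwiseDisjoint F) (ν : ℝ)
    (hν : ν = ∑ j ∈ s, (p : ℝ) ^ (F j).card) :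
    (setBernoulli (Set.univ : Set ι) p).real
      {E | 4 * ν ≤ ((s.filter fun j => (F j : Set ι) ⊆ E).card : ℝ)} ≤ Real.exp (-ν) := by
  have hp0 : (0 : ℝ) ≤ p := p.2.1
  have hν0 : 0 ≤ ν := hν ▸ Finset.sum_nonneg fun _ _ => by positivity
  -- Markov's inequality for `2 ^ X`, where `X` counts the contained blocks: its mean is at most
  -- `exp ν`, and `X ≥ 4ν` forces `2 ^ X ≥ 4 ^ (2ν) ≥ exp (2ν)`.
  have hm := mul_meas_ge_le_integral_of_nonneg (μ := setBernoulli (Set.univ : Set ι) p)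
    (f := fun E => ∏ j ∈ s, (1 + (1 : ℝ) * if (F j : Set ι) ⊆ E then 1 else 0))
    (Eventually.of_forall fun E => Finset.prod_nonneg fun j _ => by split_ifs <;> norm_num)
    Integrable.of_finite (Real.exp (2 * ν))
  rw [integral_prod_one_add_indicator p 1 s F hF] at hm
  have hprod : ∏ j ∈ s, (1 + 1 * (p : ℝ) ^ (F j).card) ≤ Real.exp ν := by
    rw [hν, Real.exp_sum]
    exact Finset.prod_le_prod (fun _ _ => by positivity)
      fun j _ => by rw [one_mul, add_comm]; exact Real.add_one_le_exp _
  have hsub : (setBernoulli (Set.univ : Set ι) p).real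
      {E | 4 * ν ≤ ((s.filter fun j => (F j : Set ι) ⊆ E).card : ℝ)} ≤
      (setBernoulli (Set.univ : Set ι) p).real
      {E | Real.exp (2 * ν) ≤ ∏ j ∈ s, (1 + (1 : ℝ) * if (F j : Set ι) ⊆ E then 1 else 0)} := by
    refine measureReal_mono fun E hE => ?_
    simp only [Set.mem_ofPred_eq] at hE ⊢
    rw [prod_one_add_indicator]
    have h4 : Real.exp 1 ≤ 4 := by linarith [Real.exp_one_lt_d9]
    calc Real.exp (2 * ν) = Real.exp 1 ^ (2 * ν) := by rw [← Real.exp_mul, one_mul]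
      _ ≤ 4 ^ (2 * ν) := Real.rpow_le_rpow (Real.exp_pos _).le h4 (by positivity)
      _ = 2 ^ (4 * ν) := by
        rw [show (4 : ℝ) = 2 ^ (2 : ℝ) by norm_num, ← Real.rpow_mul (by norm_num)]
        norm_num; ring_nf
      _ ≤ 2 ^ ((s.filter fun j => (F j : Set ι) ⊆ E).card : ℝ) :=
        Real.rpow_le_rpow_of_exponent_le (by norm_num) hE
      _ = _ := by rw [Real.rpow_natCast]; norm_num
  have hpos := Real.exp_pos (2 * ν)
  have : Real.exp (2 * ν) * (setBernoulli (Set.univ : Set ι) p).real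
      {E | 4 * ν ≤ ((s.filter fun j => (F j : Set ι) ⊆ E).card : ℝ)} ≤
      Real.exp (2 * ν) * Real.exp (-ν) := by
    refine (mul_le_mul_of_nonneg_left hsub hpos.le).trans (hm.trans (hprod.trans_eq ?_))
    rw [← Real.exp_add]; ring_nf
  exact le_of_mul_le_mul_left this hpos

open scoped Classical in
/-- Lower tail for the number of blocks `F j` that a random set contains. -/
lemma setBernoulli_lower_tail [Fintype ι] (p : unitInterval) (s : Finset κ)
    (F : κ → Finset ι) (hF : (s : Set κ).PairwiseDisjoint F) (ν : ℝ)
    (hν : ν = ∑ j ∈ s, (p : ℝ) ^ (F j).card) :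
    (setBernoulli (Set.univ : Set ι) p).real
      {E | ((s.filter fun j => (F j : Set ι) ⊆ E).card : ℝ) ≤ ν / 4} ≤ Real.exp (-(ν / 4)) := by
  have hp0 : (0 : ℝ) ≤ p := p.2.1
  have hp1 : (p : ℝ) ≤ 1 := p.2.2
  have hν0 : 0 ≤ ν := hν ▸ Finset.sum_nonneg fun _ _ => by positivity
  -- Markov's inequality for `2 ^ (-X)`: its mean is at most `exp (-ν/2)`, and `X ≤ ν/4` forces `2 ^
  -- (-X) ≥ exp (-ν/4)`.
  have hm := mul_meas_ge_le_integral_of_nonneg (μ := setBernoulli (Set.univ : Set ι) p)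
    (f := fun E => ∏ j ∈ s, (1 + (-(1 / 2) : ℝ) * if (F j : Set ι) ⊆ E then 1 else 0))
    (Eventually.of_forall fun E => Finset.prod_nonneg fun j _ => by split_ifs <;> norm_num)
    Integrable.of_finite (Real.exp (-(ν / 4)))
  rw [integral_prod_one_add_indicator p _ s F hF] at hm
  have hprod : ∏ j ∈ s, (1 + -(1 / 2) * (p : ℝ) ^ (F j).card) ≤ Real.exp (-(ν / 2)) := by
    rw [hν, Finset.sum_div, ← Finset.sum_neg_distrib, Real.exp_sum]
    refine Finset.prod_le_prod (fun j _ => ?_) fun j _ => ?_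
    · have : (p : ℝ) ^ (F j).card ≤ 1 := pow_le_one₀ hp0 hp1
      linarith
    · refine le_trans (le_of_eq ?_) (Real.add_one_le_exp _)
      ring
  have hsub : (setBernoulli (Set.univ : Set ι) p).real
      {E | ((s.filter fun j => (F j : Set ι) ⊆ E).card : ℝ) ≤ ν / 4} ≤
      (setBernoulli (Set.univ : Set ι) p).real {E | Real.exp (-(ν / 4)) ≤
        ∏ j ∈ s, (1 + (-(1 / 2) : ℝ) * if (F j : Set ι) ⊆ E then 1 else 0)} := by
    refine measureReal_mono fun E hE => ?_
    simp only [Set.mem_ofPred_eq] at hE ⊢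
    rw [prod_one_add_indicator]
    have h4 : Real.exp (-1) ≤ 1 / 2 := by
      rw [Real.exp_neg, one_div]
      exact inv_anti₀ (by norm_num) (by linarith [Real.exp_one_gt_d9])
    calc Real.exp (-(ν / 4)) ≤ Real.exp (-((s.filter fun j => (F j : Set ι) ⊆ E).card : ℝ)) :=
        Real.exp_le_exp.2 (neg_le_neg hE)
      _ = Real.exp (-1) ^ (s.filter fun j => (F j : Set ι) ⊆ E).card := by
        rw [← Real.exp_nat_mul]; ring_nf
      _ ≤ (1 / 2) ^ (s.filter fun j => (F j : Set ι) ⊆ E).card :=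
        pow_le_pow_left₀ (Real.exp_pos _).le h4 _
      _ = _ := by norm_num
  have hpos := Real.exp_pos (-(ν / 4))
  have : Real.exp (-(ν / 4)) * (setBernoulli (Set.univ : Set ι) p).real
      {E | ((s.filter fun j => (F j : Set ι) ⊆ E).card : ℝ) ≤ ν / 4} ≤
      Real.exp (-(ν / 4)) * Real.exp (-(ν / 4)) := by
    refine (mul_le_mul_of_nonneg_left hsub hpos.le).trans (hm.trans (hprod.trans_eq ?_))
    rw [← Real.exp_add]; ring_nf
  exact le_of_mul_le_mul_left this hpos

end RandomSets

/-! ### Degrees in random bipartite graphs -/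

open scoped Classical in
/-- Any two left vertices have at least `c` common neighbours, and every right vertex has at most
`D` neighbours. -/
def HasDegreeBounds {m : ℕ} (E : Set (Fin m × Fin m)) (c D : ℝ) : Prop :=
  (∀ a a' : Fin m, c ≤ (Finset.univ.filter fun b => (a, b) ∈ E ∧ (a', b) ∈ E).card) ∧
    ∀ b : Fin m, (Finset.univ.filter fun a => (a, b) ∈ E).card ≤ D

/-- A union bound over fewer than `m²` pairs and `m` right vertices. The hypothesis on `p` gives `p²
m ≥ 50 L` with `L = log (2m)`, so each tail is at most `exp (-3L) = 1 / (8 m³)`. -/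
lemma randomBipartite_hasDegreeBounds (m : ℕ) (hm : 2 ≤ m) (p : unitInterval)
    (hp : 10 * √(Real.log (2 * m : ℝ) / (2 * m : ℝ)) ≤ (p : ℝ)) :
    1 - 1 / (m : ℝ) ≤ (randomBipartite m p).real
      {E | HasDegreeBounds E ((p : ℝ) ^ 2 * m / 4) (4 * (p * m))} := by
  classical
  set μ := randomBipartite m p with hμ
  have : IsProbabilityMeasure μ := by rw [hμ, randomBipartite]; infer_instance
  have hm' : (2 : ℝ) ≤ m := by exact_mod_cast hm
  have hp0 : (0 : ℝ) ≤ p := p.2.1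
  have hp1 : (p : ℝ) ≤ 1 := p.2.2
  set L := Real.log (2 * m : ℝ) with hL
  have hL0 : 0 ≤ L := Real.log_nonneg (by linarith)
  have hμ1 : 50 * L ≤ (p : ℝ) ^ 2 * m := by
    have h1 : (10 * √(L / (2 * m : ℝ))) ^ 2 ≤ (p : ℝ) ^ 2 :=
      pow_le_pow_left₀ (by positivity) hp 2
    rw [mul_pow, Real.sq_sqrt (by positivity)] at h1
    have h2 := mul_le_mul_of_nonneg_right h1 (by linarith : (0 : ℝ) ≤ m)
    have h3 : 10 ^ 2 * (L / (2 * m)) * m = 50 * L := by field_simp; ring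
    linarith
  have hμ2 : (p : ℝ) ^ 2 * m ≤ p * m :=
    mul_le_mul_of_nonneg_right (by nlinarith) (by linarith)
  have hexp : Real.exp (-(3 * L)) = 1 / (8 * (m : ℝ) ^ 3) := by
    rw [Real.exp_neg, show 3 * L = ((3 : ℕ) : ℝ) * L by norm_num, Real.exp_nat_mul, hL,
      Real.exp_log (by linarith), one_div]
    ring
  let low : Fin m × Fin m → Set (Set (Fin m × Fin m)) := fun x =>
    {E | ((Finset.univ.filter fun b => (x.1, b) ∈ E ∧ (x.2, b) ∈ E).card : ℝ)
      ≤ (p : ℝ) ^ 2 * m / 4}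
  let high : Fin m → Set (Set (Fin m × Fin m)) := fun b =>
    {E | 4 * ((p : ℝ) * m) ≤ ((Finset.univ.filter fun a => (a, b) ∈ E).card : ℝ)}
  have hlow : ∀ x : Fin m × Fin m, x.1 ≠ x.2 → μ.real (low x) ≤ 1 / (8 * (m : ℝ) ^ 3) := by
    intro x hx
    have := setBernoulli_lower_tail p (Finset.univ : Finset (Fin m))
      (fun b => ({(x.1, b), (x.2, b)} : Finset (Fin m × Fin m)))
      (by
        intro b _ b' _ hbb
        simp only [Function.onFun, Finset.disjoint_left]
        intro e he he'
        simp only [Finset.mem_insert, Finset.mem_singleton] at he he'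
        rcases he with rfl | rfl <;> rcases he' with h | h <;>
          exact hbb (congrArg Prod.snd h)) ((p : ℝ) ^ 2 * m)
      (by
        have hc : ∀ b : Fin m, ({(x.1, b), (x.2, b)} : Finset (Fin m × Fin m)).card = 2 :=
          fun b => Finset.card_pair (by simp [hx])
        simp [hc, mul_comm])
    rw [← hexp]
    refine le_trans (le_of_eq ?_) (this.trans (Real.exp_le_exp.2 (by linarith)))
    simp only [low, hμ, randomBipartite, Finset.coe_insert, Finset.coe_singleton,
      Set.insert_subset_iff, Set.singleton_subset_iff]
  have hhigh : ∀ b : Fin m, μ.real (high b) ≤ 1 / (8 * (m : ℝ) ^ 3) := by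
    intro b
    have := setBernoulli_upper_tail p (Finset.univ : Finset (Fin m))
      (fun a => ({(a, b)} : Finset (Fin m × Fin m)))
      (by
        intro a _ a' _ haa
        simpa [Function.onFun] using haa) ((p : ℝ) * m)
      (by simp [mul_comm])
    rw [← hexp]
    refine le_trans (le_of_eq ?_) (this.trans (Real.exp_le_exp.2 (by linarith)))
    simp only [high, hμ, randomBipartite, Finset.coe_singleton, Set.singleton_subset_iff]
  let bad : Set (Set (Fin m × Fin m)) :=
    (⋃ x ∈ (Finset.univ.filter fun x : Fin m × Fin m => x.1 ≠ x.2), low x) ∪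
      ⋃ b ∈ (Finset.univ : Finset (Fin m)), high b
  have hbad : μ.real bad ≤ 1 / m := by
    have h1 := measureReal_biUnion_finset_le (μ := μ)
      (Finset.univ.filter fun x : Fin m × Fin m => x.1 ≠ x.2) low
    have h2 := measureReal_biUnion_finset_le (μ := μ) (Finset.univ : Finset (Fin m)) high
    have h3 : ∑ x ∈ (Finset.univ.filter fun x : Fin m × Fin m => x.1 ≠ x.2), μ.real (low x) ≤
        (m : ℝ) * m * (1 / (8 * (m : ℝ) ^ 3)) := by
      refine (Finset.sum_le_card_nsmul _ _ (1 / (8 * (m : ℝ) ^ 3)) fun x hx =>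
        hlow x (Finset.mem_filter.1 hx).2).trans ?_
      rw [nsmul_eq_mul]
      refine mul_le_mul_of_nonneg_right ?_ (by positivity)
      have := Finset.card_filter_le (Finset.univ : Finset (Fin m × Fin m)) (fun x => x.1 ≠ x.2)
      simp only [Finset.card_univ, Fintype.card_prod, Fintype.card_fin] at this
      exact_mod_cast this
    have h4 : ∑ b ∈ (Finset.univ : Finset (Fin m)), μ.real (high b) ≤
        (m : ℝ) * (1 / (8 * (m : ℝ) ^ 3)) := by
      refine (Finset.sum_le_card_nsmul _ _ (1 / (8 * (m : ℝ) ^ 3)) fun b _ => hhigh b).trans ?_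
      simp
    have h5 : (m : ℝ) * m * (1 / (8 * (m : ℝ) ^ 3)) + (m : ℝ) * (1 / (8 * (m : ℝ) ^ 3)) ≤ 1 / m := by
      have : (0 : ℝ) < m := by linarith
      rw [← add_mul, mul_one_div, div_le_div_iff₀ (by positivity) this]
      nlinarith [mul_pos this this, mul_pos (mul_pos this this) this]
    exact (measureReal_union_le _ _).trans (by linarith)
  have hsub : badᶜ ⊆ {E | HasDegreeBounds E ((p : ℝ) ^ 2 * m / 4) (4 * (p * m))} := by
    intro E hE
    simp only [bad, Set.compl_union, Set.compl_iUnion, Set.mem_inter_iff, Set.mem_iInter,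
      Finset.mem_filter, Finset.mem_univ, true_and, forall_true_left, Set.mem_compl_iff] at hE
    obtain ⟨hE1, hE2⟩ := hE
    have hne : ∀ a a' : Fin m, a ≠ a' → (p : ℝ) ^ 2 * m / 4 ≤
        (Finset.univ.filter fun b => (a, b) ∈ E ∧ (a', b) ∈ E).card := fun a a' h => by
      have := hE1 (a, a') h
      simp only [low, Set.mem_ofPred_eq, not_le] at this
      exact this.le
    refine ⟨fun a a' => ?_, fun b => ?_⟩
    -- On the diagonal the count is a degree, which dominates the number of common neighbours with
    -- any other vertex; one exists because `m ≥ 2`.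
    · by_cases h : a = a'
      · subst h
        have : Nontrivial (Fin m) := Fin.nontrivial_iff_two_le.2 hm
        obtain ⟨a', ha'⟩ := exists_ne a
        refine (hne a a' ha'.symm).trans ?_
        exact_mod_cast Finset.card_le_card fun b => by simp +contextual
      · exact hne a a' h
    · have := hE2 b
      simp only [high, Set.mem_ofPred_eq, not_le] at this
      exact this.le
  calc 1 - 1 / (m : ℝ) ≤ 1 - μ.real bad := by linarith
    _ = μ.real badᶜ := (probReal_compl_eq_one_sub MeasurableSet.of_discrete).symm
    _ ≤ _ := measureReal_mono hsub

/-! ### A language of bounded sums, and its compilation to the random access machine -/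

namespace RAM

lemma Runs.of_eq_steps {c : Prog} {s s' : State} {t t' : ℕ} (h : Runs c s t s') (ht : t' = t) :
    Runs c s t' s' := ht ▸ h

/-- Arithmetic terms with bounded sums; variables are de Bruijn indices. -/
inductive Term : Type
  | lit (c : ℕ)
  | var (i : ℕ)
  | add (a b : Term)
  | sub (a b : Term)
  | inp (a : Term)
  | sum (n a : Term)

/-- Extend an environment by a new variable `0`. -/
def consEnv (x : ℕ) (env : ℕ → ℕ) : ℕ → ℕ
  | 0 => x
  | i + 1 => env i

namespace Term

/-- The value of a term for a given input array and environment. -/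
def eval (I : ℕ → ℕ) : (ℕ → ℕ) → Term → ℕ
  | _, lit c => c
  | env, var i => env i
  | env, add a b => a.eval I env + b.eval I env
  | env, sub a b => a.eval I env - b.eval I env
  | env, inp a => I (a.eval I env)
  | env, sum n a => ∑ i ∈ Finset.range (n.eval I env), a.eval I (consEnv i env)

/-- The number of steps of the compiled term. -/
def cost (I : ℕ → ℕ) : (ℕ → ℕ) → Term → ℕ
  | _, lit _ => 2
  | _, var _ => 2
  | env, add a b => a.cost I env + b.cost I env + 4
  | env, sub a b => a.cost I env + b.cost I env + 4
  | env, inp a => a.cost I env + 3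
  | env, sum n a => n.cost I env + 10 +
      ∑ i ∈ Finset.range (n.eval I env), (a.cost I (consEnv i env) + 12)

/-- The program that writes the value of a term to register `r`, where variable `i` stands in
register `ρ i`, and only registers from `r` on are modified. -/
def compile : Term → (ℕ → ℕ) → ℕ → Prog
  | lit c, _, r => .set r (.lit c)
  | var i, ρ, r => .set r (.reg (ρ i))
  | add a b, ρ, r =>
      .seq (a.compile ρ r) (.seq (b.compile ρ (r + 1)) (.set r (.add (.reg r) (.reg (r + 1)))))
  | sub a b, ρ, r =>
      .seq (a.compile ρ r) (.seq (b.compile ρ (r + 1)) (.set r (.sub (.reg r) (.reg (r + 1)))))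
  | inp a, ρ, r => .seq (a.compile ρ r) (.set r (.get 0 (.reg r)))
  | sum n a, ρ, r =>
      .seq (n.compile ρ r) (.seq (.set (r + 1) (.lit 0)) (.seq (.set (r + 2) (.lit 0))
        (.seq (.while (.sub (.reg r) (.reg (r + 2)))
          (.seq (a.compile (consEnv (r + 2) ρ) (r + 3))
            (.seq (.set (r + 1) (.add (.reg (r + 1)) (.reg (r + 3))))
              (.set (r + 2) (.add (.reg (r + 2)) (.lit 1))))))
          (.set r (.reg (r + 1))))))

/-- The compiled program is correct and runs in exactly the stated time. -/
def Correct (t : Term) : Prop :=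
  ∀ (ρ : ℕ → ℕ) (r : ℕ) (s : State) (env : ℕ → ℕ), (∀ i, ρ i < r) → (∀ i, s.reg (ρ i) = env i) →
    ∃ s', Runs (t.compile ρ r) s (t.cost (s.arr 0) env) s' ∧ s'.arr = s.arr ∧
      (∀ j < r, s'.reg j = s.reg j) ∧ s'.reg r = t.eval (s.arr 0) env

/-- Induction on the number `d` of remaining iterations. Register `r` holds the bound, `r + 1` the
partial sum, `r + 2` the index, and the body works from `r + 3` on. Each iteration costs `12` steps
beyond its body; the final test costs `4`. -/
lemma Correct.while_loop {a : Term} (ha : a.Correct) (ρ : ℕ → ℕ) (r : ℕ) (env : ℕ → ℕ)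
    (hρ : ∀ i, ρ i < r) (I : ℕ → ℕ) (N : ℕ) : ∀ (d i : ℕ) (s : State), i + d = N →
    (∀ i, s.reg (ρ i) = env i) → s.arr 0 = I → s.reg r = N → s.reg (r + 2) = i →
    ∃ s', Runs (.while (.sub (.reg r) (.reg (r + 2)))
          (.seq (a.compile (consEnv (r + 2) ρ) (r + 3))
            (.seq (.set (r + 1) (.add (.reg (r + 1)) (.reg (r + 3))))
              (.set (r + 2) (.add (.reg (r + 2)) (.lit 1)))))) s
        (4 + ∑ j ∈ Finset.Ico i N, (a.cost I (consEnv j env) + 12)) s' ∧ s'.arr = s.arr ∧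
      (∀ j < r, s'.reg j = s.reg j) ∧
      s'.reg (r + 1) = s.reg (r + 1) + ∑ j ∈ Finset.Ico i N, a.eval I (consEnv j env) := by
  intro d
  induction d with
  | zero =>
    intro i s hi _ _ hN hr
    obtain rfl : i = N := by omega
    refine ⟨s, ?_, rfl, fun _ _ => rfl, by simp⟩
    simpa [Expr.cost] using Runs.while_false (e := .sub (.reg r) (.reg (r + 2)))
      (c := (.seq (a.compile (consEnv (r + 2) ρ) (r + 3))
            (.seq (.set (r + 1) (.add (.reg (r + 1)) (.reg (r + 3))))
              (.set (r + 2) (.add (.reg (r + 2)) (.lit 1)))))) (s := s) (by simp [Expr.eval, hN, hr])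
  | succ d ih =>
    intro i s hi henv hI hN hr
    obtain ⟨s₁, hrun, harr, hreg, hres⟩ := ha (consEnv (r + 2) ρ) (r + 3) s (consEnv i env)
      (by rintro (_ | j); exacts [by simp [consEnv], (hρ j).trans (by omega)])
      (by rintro (_ | j); exacts [hr, henv j])
    let s₂ := s₁.setReg (r + 1) (s₁.reg (r + 1) + s₁.reg (r + 3))
    let s₃ := s₂.setReg (r + 2) (s₂.reg (r + 2) + 1)
    have hlow : ∀ j < r, s₃.reg j = s.reg j := by
      intro j hj
      rw [← hreg j (by omega)]
      simp [s₃, s₂, State.setReg, Function.update_of_ne, show j ≠ r + 2 by omega,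
        show j ≠ r + 1 by omega]
    obtain ⟨s', hrun', harr', hreg', hres'⟩ := ih (i + 1) s₃ (by omega)
      (fun j => (hlow _ (hρ j)).trans (henv j)) (by
        change s₁.arr 0 = I
        rw [harr, hI]) (by
        rw [← hN, ← hreg r (by omega)]
        simp [s₃, s₂, State.setReg]) (by
        simp [s₃, s₂, State.setReg, hreg (r + 2) (by omega), hr])
    refine ⟨s', ?_, ?_, fun j hj => (hreg' j hj).trans (hlow j hj), ?_⟩
    · have hbody := Runs.seq hrun (Runs.seq
        (Runs.set s₁ (r + 1) (.add (.reg (r + 1)) (.reg (r + 3))))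
        (Runs.set s₂ (r + 2) (.add (.reg (r + 2)) (.lit 1))))
      have h := Runs.while_true (e := .sub (.reg r) (.reg (r + 2)))
        (by simp only [Expr.eval, hN, hr]; omega) hbody hrun'
      refine h.of_eq_steps ?_
      rw [Finset.sum_eq_sum_Ico_succ_bot (by omega), hI]
      simp only [Expr.cost]
      ring
    · rw [harr']
      exact harr
    · rw [hres', Finset.sum_eq_sum_Ico_succ_bot (show i < N by omega), ← add_assoc]
      congr 1
      simp [s₃, s₂, State.setReg, hreg (r + 1) (by omega), hres, hI]

theorem correct (t : Term) : t.Correct := by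
  induction t with
  | lit c =>
    intro ρ r s env _ _
    refine ⟨_, Runs.set s r (.lit c), rfl, fun j hj => ?_, ?_⟩
    · simp [State.setReg, hj.ne]
    · simp [State.setReg, eval, Expr.eval]
  | var i =>
    intro ρ r s env _ henv
    refine ⟨_, Runs.set s r (.reg (ρ i)), rfl, fun j hj => ?_, ?_⟩
    · simp [State.setReg, hj.ne]
    · simp [State.setReg, eval, Expr.eval, henv]
  | add a b iha ihb =>
    intro ρ r s env hρ henv
    obtain ⟨s₁, hrun₁, harr₁, hreg₁, hres₁⟩ := iha ρ r s env hρ henv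
    obtain ⟨s₂, hrun₂, harr₂, hreg₂, hres₂⟩ := ihb ρ (r + 1) s₁ env
      (fun i => (hρ i).trans (by omega)) (fun i => (hreg₁ _ (hρ i)).trans (henv i))
    refine ⟨s₂.setReg r (s₂.reg r + s₂.reg (r + 1)), ?_, ?_, fun j hj => ?_, ?_⟩
    · refine (Runs.seq hrun₁ (Runs.seq hrun₂
        (Runs.set s₂ r (.add (.reg r) (.reg (r + 1)))))).of_eq_steps ?_
      simp only [cost, Expr.cost, harr₁]
      ring
    · exact harr₂.trans harr₁
    · rw [← hreg₁ j hj, ← hreg₂ j (by omega)]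
      simp [State.setReg, hj.ne]
    · simp [State.setReg, eval, hres₂, hreg₂ r (by omega), hres₁, harr₁]
  | sub a b iha ihb =>
    intro ρ r s env hρ henv
    obtain ⟨s₁, hrun₁, harr₁, hreg₁, hres₁⟩ := iha ρ r s env hρ henv
    obtain ⟨s₂, hrun₂, harr₂, hreg₂, hres₂⟩ := ihb ρ (r + 1) s₁ env
      (fun i => (hρ i).trans (by omega)) (fun i => (hreg₁ _ (hρ i)).trans (henv i))
    refine ⟨s₂.setReg r (s₂.reg r - s₂.reg (r + 1)), ?_, ?_, fun j hj => ?_, ?_⟩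
    · refine (Runs.seq hrun₁ (Runs.seq hrun₂
        (Runs.set s₂ r (.sub (.reg r) (.reg (r + 1)))))).of_eq_steps ?_
      simp only [cost, Expr.cost, harr₁]
      ring
    · exact harr₂.trans harr₁
    · rw [← hreg₁ j hj, ← hreg₂ j (by omega)]
      simp [State.setReg, hj.ne]
    · simp [State.setReg, eval, hres₂, hreg₂ r (by omega), hres₁, harr₁]
  | inp a iha =>
    intro ρ r s env hρ henv
    obtain ⟨s₁, hrun₁, harr₁, hreg₁, hres₁⟩ := iha ρ r s env hρ henv
    refine ⟨s₁.setReg r (s₁.arr 0 (s₁.reg r)), ?_, harr₁, fun j hj => ?_, ?_⟩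
    · exact Runs.seq hrun₁ (Runs.set s₁ r (.get 0 (.reg r)))
    · rw [← hreg₁ j hj]
      simp [State.setReg, hj.ne]
    · simp [State.setReg, eval, hres₁, harr₁]
  | sum n a ihn iha =>
    intro ρ r s env hρ henv
    obtain ⟨s₁, hrun₁, harr₁, hreg₁, hres₁⟩ := ihn ρ r s env hρ henv
    let s₂ := s₁.setReg (r + 1) 0
    let s₃ := s₂.setReg (r + 2) 0
    have hlow : ∀ j < r, s₃.reg j = s.reg j := by
      intro j hj
      rw [← hreg₁ j hj]
      simp [s₃, s₂, State.setReg, show j ≠ r + 2 by omega, show j ≠ r + 1 by omega]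
    obtain ⟨s₄, hrun₄, harr₄, hreg₄, hres₄⟩ := iha.while_loop ρ r env hρ (s.arr 0)
      (n.eval (s.arr 0) env) (n.eval (s.arr 0) env) 0 s₃ (by omega)
      (fun j => (hlow _ (hρ j)).trans (henv j)) (congrFun harr₁ 0)
      (by rw [← hres₁]; simp [s₃, s₂, State.setReg]) (by simp [s₃, State.setReg])
    refine ⟨s₄.setReg r (s₄.reg (r + 1)), ?_, harr₄.trans harr₁, fun j hj => ?_, ?_⟩
    · refine (Runs.seq hrun₁ (Runs.seq (Runs.set s₁ (r + 1) (.lit 0))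
        (Runs.seq (Runs.set s₂ (r + 2) (.lit 0))
          (Runs.seq hrun₄ (Runs.set s₄ r (.reg (r + 1))))))).of_eq_steps ?_
      simp only [cost, Expr.cost, Finset.range_eq_Ico]
      ring
    · refine Eq.trans ?_ ((hreg₄ j hj).trans (hlow j hj))
      simp [State.setReg, hj.ne]
    · simp [State.setReg, eval, hres₄, s₃, s₂]

/-- Values and running times of terms are polynomial in the size of the data. -/
theorem exists_poly_bound (t : Term) : ∃ c : ℕ, ∀ (B : ℕ) (I env : ℕ → ℕ), 2 ≤ B →
    (∀ i, I i ≤ B) → (∀ i, env i ≤ B) → t.eval I env ≤ B ^ (c + 1) ∧ t.cost I env ≤ B ^ (c + 1) := by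
  have two_le : ∀ B c : ℕ, 2 ≤ B → 2 ≤ B ^ (c + 1) := fun B c hB =>
    hB.trans (Nat.le_self_pow (by omega) B)
  have hadd : ∀ B c d x y : ℕ, 2 ≤ B → x ≤ B ^ (c + 1) → y ≤ B ^ (d + 1) →
      x + y + 4 ≤ B ^ (c + d + 4 + 1) := by
    intro B c d x y hB hx hy
    have h1 := two_le B c hB
    have h2 := two_le B d hB
    have h3 : 2 ^ 3 ≤ B ^ 3 := Nat.pow_le_pow_left hB 3
    calc x + y + 4 ≤ B ^ (c + 1) + B ^ (d + 1) + 4 := by omega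
      _ ≤ (B ^ (c + 1) * B ^ (d + 1)) * 2 ^ 3 := by nlinarith
      _ ≤ (B ^ (c + 1) * B ^ (d + 1)) * B ^ 3 := Nat.mul_le_mul_left _ h3
      _ = _ := by ring
  induction t with
  | lit k =>
    refine ⟨k, fun B I env hB _ _ => ⟨?_, two_le B k hB⟩⟩
    exact (Nat.lt_pow_self (n := k) (by omega : 1 < B)).le.trans (Nat.pow_le_pow_right (by omega) (by omega))
  | var i => exact ⟨0, fun B I env hB _ h => ⟨by simpa [eval] using h i, two_le B 0 hB⟩⟩
  | add a b iha ihb =>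
    obtain ⟨c, hc⟩ := iha
    obtain ⟨d, hd⟩ := ihb
    refine ⟨c + d + 4, fun B I env hB hI henv => ⟨?_, ?_⟩⟩
    · exact (Nat.le_add_right _ 4).trans
        (hadd B c d _ _ hB (hc B I env hB hI henv).1 (hd B I env hB hI henv).1)
    · exact hadd B c d _ _ hB (hc B I env hB hI henv).2 (hd B I env hB hI henv).2
  | sub a b iha ihb =>
    obtain ⟨c, hc⟩ := iha
    obtain ⟨d, hd⟩ := ihb
    refine ⟨c + d + 4, fun B I env hB hI henv => ⟨?_, ?_⟩⟩
    · exact ((Nat.sub_le _ _).trans (by omega)).trans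
        (hadd B c d _ _ hB (hc B I env hB hI henv).1 (hd B I env hB hI henv).1)
    · exact hadd B c d _ _ hB (hc B I env hB hI henv).2 (hd B I env hB hI henv).2
  | inp a iha =>
    obtain ⟨c, hc⟩ := iha
    refine ⟨c + 0 + 4, fun B I env hB hI henv => ⟨?_, ?_⟩⟩
    · exact (hI _).trans (Nat.le_self_pow (by omega) B)
    · refine le_trans ?_ (hadd B c 0 _ 0 hB (hc B I env hB hI henv).2 (by omega))
      simp only [cost]
      omega
  | sum n a ihn iha =>
    obtain ⟨c, hc⟩ := ihn
    obtain ⟨d, hd⟩ := iha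
    refine ⟨(c + 1) + (c + 1) * (d + 1) + 4, fun B I env hB hI henv => ?_⟩
    obtain ⟨hn, hn'⟩ := hc B I env hB hI henv
    have hB' : B ≤ B ^ (c + 1) := Nat.le_self_pow (by omega) B
    have h1 := two_le B c hB
    have h2 : 2 ≤ B ^ ((c + 1) * (d + 1)) := by
      rw [pow_mul]
      exact two_le _ d h1
    have ha : ∀ i ∈ Finset.range (n.eval I env),
        a.eval I (consEnv i env) ≤ B ^ ((c + 1) * (d + 1)) ∧
        a.cost I (consEnv i env) ≤ B ^ ((c + 1) * (d + 1)) := by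
      intro i hi
      rw [pow_mul]
      -- The summation variable can be as large as `B ^ (c + 1)`, so the induction hypothesis for
      -- the body is applied with this number as the new bound; exponents multiply.
      refine hd (B ^ (c + 1)) I _ h1 (fun j => (hI j).trans hB') ?_
      rintro (_ | j)
      · exact ((Finset.mem_range.1 hi).le).trans hn
      · exact (henv j).trans hB'
    have h3 : 2 ^ 5 ≤ B ^ 5 := Nat.pow_le_pow_left hB 5
    have hfin : B ^ (c + 1) + 10 + B ^ (c + 1) * (B ^ ((c + 1) * (d + 1)) + 12) ≤
        B ^ ((c + 1) + (c + 1) * (d + 1) + 4 + 1) := by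
      calc _ ≤ (B ^ (c + 1) * B ^ ((c + 1) * (d + 1))) * 2 ^ 5 := by nlinarith
        _ ≤ (B ^ (c + 1) * B ^ ((c + 1) * (d + 1))) * B ^ 5 := Nat.mul_le_mul_left _ h3
        _ = _ := by ring
    constructor
    · have := Finset.sum_le_card_nsmul _ _ _ fun i hi => (ha i hi).1
      simp only [Finset.card_range, smul_eq_mul] at this
      refine le_trans (this.trans (Nat.mul_le_mul_right _ hn)) (le_trans ?_ hfin)
      nlinarith
    · have := Finset.sum_le_card_nsmul _ _ (B ^ ((c + 1) * (d + 1)) + 12)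
        fun i hi => Nat.add_le_add_right (ha i hi).2 12
      simp only [Finset.card_range, smul_eq_mul] at this
      have h4 := this.trans (Nat.mul_le_mul_right _ hn)
      simp only [cost]
      omega

/-- Renaming of variables. -/
def rename : (ℕ → ℕ) → Term → Term
  | _, lit c => lit c
  | ρ, var i => var (ρ i)
  | ρ, add a b => add (a.rename ρ) (b.rename ρ)
  | ρ, sub a b => sub (a.rename ρ) (b.rename ρ)
  | ρ, inp a => inp (a.rename ρ)
  | ρ, sum n a => sum (n.rename ρ) (a.rename (consEnv 0 fun i => ρ i + 1))

lemma eval_rename (I : ℕ → ℕ) (t : Term) (ρ env : ℕ → ℕ) :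
    (t.rename ρ).eval I env = t.eval I fun i => env (ρ i) := by
  induction t generalizing ρ env with
  | lit c => rfl
  | var i => rfl
  | add a b iha ihb => simp only [rename, eval, iha, ihb]
  | sub a b iha ihb => simp only [rename, eval, iha, ihb]
  | inp a iha => simp only [rename, eval, iha]
  | sum n a ihn iha =>
    simp only [rename, eval, ihn, iha]
    refine Finset.sum_congr rfl fun j _ => ?_
    congr 1
    funext i
    cases i <;> rfl

end Term

/-! ### Functions expressible in the language -/

/-- The context `κ` with one more variable. -/
abbrev extCtx {X : Type} (κ : X → (ℕ → ℕ) × (ℕ → ℕ)) : X × ℕ → (ℕ → ℕ) × (ℕ → ℕ) :=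
  fun y => ((κ y.1).1, consEnv y.2 (κ y.1).2)

/-- The function `f` is given by a term, where `κ x` are the input array and the environment that
belong to `x`. -/
def Expressible {X : Type} (κ : X → (ℕ → ℕ) × (ℕ → ℕ)) (f : X → ℕ) : Prop :=
  ∃ t : Term, ∀ x, t.eval (κ x).1 (κ x).2 = f x

namespace Expressible

variable {X Y : Type} {κ : X → (ℕ → ℕ) × (ℕ → ℕ)} {f g n : X → ℕ}

lemma const (c : ℕ) : Expressible κ fun _ => c := ⟨.lit c, fun _ => rfl⟩

lemma bvar : Expressible (extCtx κ) fun y => y.2 := ⟨.var 0, fun _ => rfl⟩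

lemma add (hf : Expressible κ f) (hg : Expressible κ g) : Expressible κ fun x => f x + g x := by
  obtain ⟨a, ha⟩ := hf
  obtain ⟨b, hb⟩ := hg
  exact ⟨.add a b, fun x => by simp only [Term.eval, ha, hb]⟩

lemma sub (hf : Expressible κ f) (hg : Expressible κ g) : Expressible κ fun x => f x - g x := by
  obtain ⟨a, ha⟩ := hf
  obtain ⟨b, hb⟩ := hg
  exact ⟨.sub a b, fun x => by simp only [Term.eval, ha, hb]⟩

lemma inp (hf : Expressible κ f) : Expressible κ fun x => (κ x).1 (f x) := by
  obtain ⟨a, ha⟩ := hf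
  exact ⟨.inp a, fun x => by simp only [Term.eval, ha]⟩

lemma sum {h : X → ℕ → ℕ} (hn : Expressible κ n)
    (hh : Expressible (extCtx κ) fun y => h y.1 y.2) :
    Expressible κ fun x => ∑ i ∈ Finset.range (n x), h x i := by
  obtain ⟨a, ha⟩ := hn
  obtain ⟨b, hb⟩ := hh
  refine ⟨.sum a b, fun x => ?_⟩
  simp only [Term.eval, ha]
  exact Finset.sum_congr rfl fun i _ => hb (x, i)

lemma rename {κ' : Y → (ℕ → ℕ) × (ℕ → ℕ)} (hf : Expressible κ f) (h : Y → X) (ρ : ℕ → ℕ)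
    (h₁ : ∀ y, (κ (h y)).1 = (κ' y).1) (h₂ : ∀ y i, (κ (h y)).2 i = (κ' y).2 (ρ i)) :
    Expressible κ' fun y => f (h y) := by
  obtain ⟨t, ht⟩ := hf
  refine ⟨t.rename ρ, fun y => ?_⟩
  change _ = f (h y)
  rw [Term.eval_rename, ← ht (h y), h₁]
  congr 1
  funext i
  exact (h₂ y i).symm

lemma weaken (hf : Expressible κ f) : Expressible (extCtx κ) fun y => f y.1 :=
  hf.rename Prod.fst Nat.succ (fun _ => rfl) fun _ _ => rfl

/-- Multiplication is a sum of `f x` equal terms, since the machine only adds and subtracts. -/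
lemma mul (hf : Expressible κ f) (hg : Expressible κ g) : Expressible κ fun x => f x * g x := by
  have : (fun x => f x * g x) = fun x => ∑ _i ∈ Finset.range (f x), g x := by
    funext x
    simp
  rw [this]
  exact hf.sum hg.weaken

lemma pow_const (hf : Expressible κ f) (k : ℕ) : Expressible κ fun x => f x ^ k := by
  induction k with
  | zero => simpa using const 1
  | succ k ih => simpa only [pow_succ] using ih.mul hf

/-- Here the number of summands is fixed, so the sum is unrolled and the term may depend on `i`
arbitrarily, for instance through an exponent. -/
lemma sum_const {h : ℕ → X → ℕ} (k : ℕ) (hh : ∀ i, Expressible κ (h i)) :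
    Expressible κ fun x => ∑ i ∈ Finset.range k, h i x := by
  induction k with
  | zero => simpa using const 0
  | succ k ih => simpa only [Finset.sum_range_succ] using ih.add (hh k)

end Expressible

/-! ### Division and maximization by bounded sums -/

/-- The quotient counts the `i < x` with `(i + 1) y ≤ x`; the prefactor is the indicator of `y ≠ 0`,
as division by `0` gives `0`. -/
lemma div_eq_sum (x y : ℕ) :
    x / y = (1 - (1 - y)) * ∑ i ∈ Finset.range x, (1 - ((i + 1) * y - x)) := by
  rcases Nat.eq_zero_or_pos y with rfl | hy
  · simp
  have h : ∀ i, 1 - ((i + 1) * y - x) = if i < x / y then 1 else 0 := by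
    intro i
    have : i < x / y ↔ (i + 1) * y ≤ x := by rw [← Nat.succ_le_iff, Nat.le_div_iff_mul_le hy]
    simp only [this]
    split_ifs <;> omega
  simp only [h, Finset.sum_boole, Nat.cast_id]
  have : (Finset.range x).filter (· < x / y) = Finset.range (x / y) := by
    ext i
    have := Nat.div_le_self x y
    simp only [Finset.mem_filter, Finset.mem_range]
    omega
  rw [this, Finset.card_range, show 1 - (1 - y) = 1 by omega, one_mul]

/-- The first maximizer of `f` on `{0, …, n - 1}`, in terms of bounded sums. -/
def argmax (n : ℕ) (f : ℕ → ℕ) : ℕ :=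
  ∑ z ∈ Finset.range n, (1 - ∑ y ∈ Finset.range (z + 1), (1 - ∑ x ∈ Finset.range n, (f x - f y)))

/-- The outer sum counts the `z` for which no `y ≤ z` is a maximizer, that is, the numbers below the
first maximizer. -/
lemma argmax_spec {n : ℕ} (hn : 0 < n) (f : ℕ → ℕ) :
    argmax n f < n ∧ ∀ x < n, f x ≤ f (argmax n f) := by
  classical
  have hex : ∃ y, y < n ∧ ∀ x < n, f x ≤ f y := by
    obtain ⟨y, hy, h⟩ := Finset.exists_max_image (Finset.range n) f ⟨0, Finset.mem_range.2 hn⟩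
    exact ⟨y, Finset.mem_range.1 hy, fun x hx => h x (Finset.mem_range.2 hx)⟩
  have h₁ : ∀ y, (∑ x ∈ Finset.range n, (f x - f y)) = 0 ↔ ∀ x < n, f x ≤ f y := by
    intro y
    simp [Finset.sum_eq_zero_iff, Nat.sub_eq_zero_iff_le]
  have h₂ : ∀ z < n, (1 - ∑ y ∈ Finset.range (z + 1), (1 - ∑ x ∈ Finset.range n, (f x - f y)))
      = if z < Nat.find hex then 1 else 0 := by
    intro z hz
    split_ifs with h
    · have : ∑ y ∈ Finset.range (z + 1), (1 - ∑ x ∈ Finset.range n, (f x - f y)) = 0 := by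
        refine Finset.sum_eq_zero fun y hy => ?_
        have hy' := Finset.mem_range.1 hy
        have := Nat.find_min hex (m := y) (by omega)
        have h0 : ∑ x ∈ Finset.range n, (f x - f y) ≠ 0 := fun h0 =>
          this ⟨by omega, (h₁ y).1 h0⟩
        omega
      rw [this]
    · have hle := Finset.single_le_sum
        (f := fun y => 1 - ∑ x ∈ Finset.range n, (f x - f y)) (s := Finset.range (z + 1))
        (fun _ _ => Nat.zero_le _) (Finset.mem_range.2 (show Nat.find hex < z + 1 by omega))
      simp only [(h₁ _).2 (Nat.find_spec hex).2] at hle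
      omega
  have h₃ : argmax n f = Nat.find hex := by
    rw [argmax, Finset.sum_congr rfl fun z hz => h₂ z (Finset.mem_range.1 hz)]
    simp only [Finset.sum_boole, Nat.cast_id]
    have : (Finset.range n).filter (· < Nat.find hex) = Finset.range (Nat.find hex) := by
      ext i
      have := (Nat.find_spec hex).1
      simp only [Finset.mem_filter, Finset.mem_range]
      omega
    rw [this, Finset.card_range]
  rw [h₃]
  exact Nat.find_spec hex

namespace Expressible

variable {X : Type} {κ : X → (ℕ → ℕ) × (ℕ → ℕ)} {f g n : X → ℕ}

lemma div (hf : Expressible κ f) (hg : Expressible κ g) : Expressible κ fun x => f x / g x := by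
  simp only [div_eq_sum]
  exact ((const 1).sub ((const 1).sub hg)).mul
    (hf.sum ((const 1).sub (((bvar.add (const 1)).mul hg.weaken).sub hf.weaken)))

lemma mod (hf : Expressible κ f) (hg : Expressible κ g) : Expressible κ fun x => f x % g x := by
  simp only [Nat.mod_eq_sub]
  exact hf.sub (hg.mul (hf.div hg))

lemma argmax {h : X → ℕ → ℕ} (hn : Expressible κ n)
    (hh : Expressible (extCtx κ) fun y => h y.1 y.2) :
    Expressible κ fun x => argmax (n x) (h x) := by
  refine hn.sum ((const 1).sub ((bvar.add (const 1)).sum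
    ((const 1).sub (hn.weaken.weaken.sum (sub ?_ ?_)))))
  -- Under the three binders `z`, `y`, `x`, the argument of `h` is variable `0` (for `f x`) or `1`
  -- (for `f y`), and the outer variables move up by `3`.
  · exact hh.rename (fun w : ((X × ℕ) × ℕ) × ℕ => (w.1.1.1, w.2)) (consEnv 0 fun i => i + 3) (fun _ => rfl)
      (by rintro y (_ | i) <;> rfl)
  · exact hh.rename (fun w : ((X × ℕ) × ℕ) × ℕ => (w.1.1.1, w.1.2)) (consEnv 1 fun i => i + 3) (fun _ => rfl)
      (by rintro y (_ | i) <;> rfl)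

end Expressible

/-! ### Writing an expressible function to the output array -/

/-- The program that writes the values of the term `t` at `0, …, 2 m - 1` to array `1`, where `m`
is the first entry of the input. -/
def tabulate (t : Term) : Prog :=
  .while (.sub (.add (.get 0 (.lit 0)) (.get 0 (.lit 0))) (.reg 0))
    (.seq (t.compile (consEnv 0 fun _ => 1) 2)
      (.seq (.put 1 (.reg 0) (.reg 2)) (.set 0 (.add (.reg 0) (.lit 1)))))

/-- Register `0` is both the loop counter and variable `0` of the term; register `1` stays `0` and
serves as all other variables. Test, output and increment take `15` steps per round. -/
lemma runs_tabulate (t : Term) (I : ℕ → ℕ) (m B : ℕ) (hm : I 0 = m)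
    (hB : ∀ j < 2 * m, t.cost I (consEnv j fun _ => 0) ≤ B) : ∀ (d i : ℕ) (s : State),
    i + d = 2 * m → s.arr 0 = I → s.reg 1 = 0 → s.reg 0 = i →
    ∃ u s', Runs (tabulate t) s u s' ∧ u ≤ 8 + d * (B + 15) ∧
      (∀ j < i, s'.arr 1 j = s.arr 1 j) ∧
      ∀ j, i ≤ j → j < 2 * m → s'.arr 1 j = t.eval I (consEnv j fun _ => 0) := by
  intro d
  induction d with
  | zero =>
    intro i s hi hI _ h0
    refine ⟨_, s, Runs.while_false ?_, ?_, fun _ _ => rfl, fun j h h' => by omega⟩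
    · simp only [Expr.eval, h0, hI, hm]
      omega
    · simp [Expr.cost]
  | succ d ih =>
    intro i s hi hI h1 h0
    obtain ⟨s₁, hrun, harr, hreg, hres⟩ := t.correct (consEnv 0 fun _ => 1) 2 s
      (consEnv i fun _ => 0) (by rintro (_ | j) <;> simp [consEnv])
      (by rintro (_ | j); exacts [h0, h1])
    let s₂ := s₁.setArr 1 (s₁.reg 0) (s₁.reg 2)
    let s₃ := s₂.setReg 0 (s₂.reg 0 + 1)
    obtain ⟨u, s', hrun', hu, hlow, hhigh⟩ := ih (i + 1) s₃ (by omega)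
      (by simp [s₃, s₂, State.setReg, State.setArr, harr, hI])
      (by simp [s₃, s₂, State.setReg, State.setArr, hreg 1 (by omega), h1])
      (by simp [s₃, s₂, State.setReg, State.setArr, hreg 0 (by omega), h0])
    have hbody := Runs.seq hrun (Runs.seq (Runs.put s₁ 1 (.reg 0) (.reg 2))
      (Runs.set s₂ 0 (.add (.reg 0) (.lit 1))))
    refine ⟨_, s', Runs.while_true ?_ hbody hrun', ?_, fun j hj => ?_, fun j hj hj' => ?_⟩
    · simp only [Expr.eval, h0, hI, hm]
      omega
    · have := hB i (by omega)
      simp only [Expr.cost, hI]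
      rw [add_mul]
      omega
    · rw [hlow j (by omega)]
      simp [s₃, s₂, State.setReg, State.setArr, hreg 0 (by omega), h0, hj.ne, harr]
    · rcases hj.eq_or_lt with rfl | hlt
      · rw [hlow i (by omega)]
        simp [s₃, s₂, State.setReg, State.setArr, hreg 0 (by omega), h0, hres, hI]
      · exact hhigh j hlt hj'

end RAM

/-! ### The written-out game -/

namespace ProjectionGame

variable {m q : ℕ} (G : ProjectionGame (Fin m) (Fin m) q)

/-- The input array that holds the written-out game. -/
noncomputable def input (x : ℕ) : ℕ := G.encode.getD x 0

lemma input_zero : G.input 0 = m := by simp [input, encode]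

lemma input_one : G.input 1 = q := by simp [input, encode]

open scoped Classical in
lemma input_adj (a b : Fin m) :
    G.input (2 + (b + m * a)) = if (a, b) ∈ G.edges then 1 else 0 := by
  have hlt : (b : ℕ) + m * a < m * m := by
    simpa using (finProdFinEquiv (a, b)).2
  have hi : (⟨b + m * a, hlt⟩ : Fin (m * m)) = finProdFinEquiv (a, b) := by
    ext
    simp
  rw [input, encode, List.getD_append _ _ _ _ (by simp; omega),
    List.getD_append_right _ _ _ _ (by simp), List.getD_eq_getElem _ _ (by simpa using hlt),
    List.getElem_ofFn]
  simp only [List.length_cons, List.length_nil, zero_add, Nat.reduceAdd, Nat.add_sub_cancel_left,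
    hi, Equiv.symm_apply_apply]

open scoped Classical in
lemma input_proj (a b : Fin m) (σ : Fin q) :
    G.input (2 + m * m + (σ + q * (b + m * a))) =
      if h : (a, b) ∈ G.edges then (G.proj ⟨_, h⟩ σ : ℕ) else 0 := by
  have hlt : (σ : ℕ) + q * (b + m * a) < m * m * q := by
    simpa using (finProdFinEquiv (finProdFinEquiv (a, b), σ)).2
  have hi : (⟨σ + q * (b + m * a), hlt⟩ : Fin (m * m * q))
      = finProdFinEquiv (finProdFinEquiv (a, b), σ) := by
    ext
    simp
  rw [input, encode, List.getD_append_right _ _ _ _ (by simp; omega),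
    List.getD_eq_getElem _ _ (by simp; omega), List.getElem_ofFn]
  simp only [List.length_append, List.length_ofFn, List.length_cons, List.length_nil, zero_add,
    Nat.reduceAdd, Nat.add_sub_cancel_left, hi, Equiv.symm_apply_apply]

lemma input_le (hm : 0 < m) (hq : 0 < q) (x : ℕ) : G.input x ≤ 2 * m * q + 2 := by
  have h1 : m ≤ m * q := Nat.le_mul_of_pos_right m hq
  have h2 : q ≤ m * q := Nat.le_mul_of_pos_left q hm
  have h3 : 2 * m * q = 2 * (m * q) := by ring
  rw [input]
  by_cases hx : x < G.encode.length
  · rw [List.getD_eq_getElem _ _ hx]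
    have hmem := List.getElem_mem hx
    generalize G.encode[x] = y at hmem
    simp only [encode, List.mem_append, List.mem_cons, List.not_mem_nil, or_false,
      List.mem_ofFn] at hmem
    rcases hmem with ((rfl | rfl) | ⟨i, rfl⟩) | ⟨i, rfl⟩
    · omega
    · omega
    · split_ifs <;> omega
    · split_ifs
      · refine (Fin.is_lt _).le.trans ?_
        omega
      · omega
  · rw [List.getD_eq_default _ _ (by omega)]
    omega

end ProjectionGame

open RAM in
/-- An algorithm whose output is expressible in the language of bounded sums runs in polynomial
time. -/
theorem ProjectionGameAlgorithm.isPolyTime_of_expressible (alg : ProjectionGameAlgorithm)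
    (out : (ℕ → ℕ) → ℕ → ℕ)
    (hout : Expressible (extCtx fun I : ℕ → ℕ => (I, fun _ => 0)) fun y => out y.1 y.2)
    (hl : ∀ (m q : ℕ) [NeZero q] (G : ProjectionGame (Fin m) (Fin m) q) (a : Fin m),
      out G.input a = alg m q G (Sum.inl a))
    (hr : ∀ (m q : ℕ) [NeZero q] (G : ProjectionGame (Fin m) (Fin m) q) (b : Fin m),
      out G.input (m + b) = alg m q G (Sum.inr b)) : alg.IsPolyTime := by
  obtain ⟨t, ht⟩ := hout
  obtain ⟨c, hc⟩ := t.exists_poly_bound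
  -- The case `m = 0` is separated because `N = 0` then, whereas the input still contains an
  -- arbitrary `q`, so `input_le` has no analogue. The constant `11` is `3` for this test plus `8`
  -- for the last test of the loop.
  refine ⟨.ite (.get 0 (.lit 0)) (tabulate t) .skip,
    (Polynomial.X + 2) * ((Polynomial.X + 2) ^ (c + 1) + 15) + 11, fun m q _ G => ?_⟩
  have hq : 0 < q := NeZero.pos q
  have hinit : (RAM.init G.encode).arr 0 = G.input := by
    funext x
    simp [RAM.init, ProjectionGame.input]
  have heval : (Expr.get 0 (.lit 0)).eval (RAM.init G.encode) = m := by
    simp only [Expr.eval, hinit, G.input_zero]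
  have hT : Polynomial.eval (2 * m * q)
      ((Polynomial.X + 2) * ((Polynomial.X + 2) ^ (c + 1) + 15) + 11 : Polynomial ℕ) =
      (2 * m * q + 2) * ((2 * m * q + 2) ^ (c + 1) + 15) + 11 := by
    simp
  rcases Nat.eq_zero_or_pos m with rfl | hm
  · refine ⟨_, _, Runs.ite_false heval (Runs.skip _), ?_, fun a => a.elim0, fun a => a.elim0⟩
    rw [hT]
    simp only [Expr.cost]
    omega
  · have hN : 2 * m ≤ 2 * m * q := Nat.le_mul_of_pos_right _ hq
    obtain ⟨u, s, hrun, hu, -, hs⟩ := runs_tabulate t G.input m ((2 * m * q + 2) ^ (c + 1))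
      G.input_zero
      (fun j hj => (hc (2 * m * q + 2) G.input (consEnv j fun _ => 0) (by omega)
        (G.input_le hm hq) (by rintro (_ | i) <;> simp only [consEnv] <;> omega)).2)
      (2 * m) 0 (RAM.init G.encode) (by omega) hinit rfl rfl
    refine ⟨_, s, Runs.ite_true (by omega) hrun, ?_, fun a => ?_, fun b => ?_⟩
    · rw [hT]
      simp only [Expr.cost]
      have := Nat.mul_le_mul_right ((2 * m * q + 2) ^ (c + 1) + 15)
        (show 2 * m ≤ 2 * m * q + 2 by omega)
      omega
    · rw [hs a (by omega) (by omega), ← hl]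
      exact ht (G.input, a)
    · rw [hs (m + b) (by omega) (by omega), ← hr]
      exact ht (G.input, m + b)

/-! ### The algorithm, on the input array -/

namespace SeedSearch

open RAM

/-- Whether the left vertex `a` and the right vertex `b` are adjacent. -/
def adj (I : ℕ → ℕ) (a b : ℕ) : ℕ := I (2 + (b + I 0 * a))

/-- The projection of the pair `(a, b)` at the letter `σ`. -/
def prj (I : ℕ → ℕ) (a b σ : ℕ) : ℕ := I (2 + I 0 * I 0 + (σ + I 1 * (b + I 0 * a)))

/-- The indicator of `x = y`. -/
def eqInd (x y : ℕ) : ℕ := 1 - ((x - y) + (y - x))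

lemma eqInd_eq (x y : ℕ) : eqInd x y = if x = y then 1 else 0 := by
  unfold eqInd
  split_ifs <;> omega

/-- The `i`-th digit of the code `z` of a tuple of pairs of a vertex and a letter. -/
def digit (I : ℕ → ℕ) (z i : ℕ) : ℕ := z / (I 0 * I 1) ^ i % (I 0 * I 1)

/-- The number of conflicts of the letter `σ` at `a` with the first `k` pairs coded by `z`. -/
def conflicts (k : ℕ) (I : ℕ → ℕ) (z a σ : ℕ) : ℕ :=
  ∑ i ∈ Finset.range k, ∑ b ∈ Finset.range (I 0),
    adj I (digit I z i / I 1) b * (adj I a b *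
      (1 - eqInd (prj I a b σ) (prj I (digit I z i / I 1) b (digit I z i % I 1))))

/-- The weight of the letters at `a`: about `q` divided by the number of letters without
conflict. -/
def weight (k : ℕ) (I : ℕ → ℕ) (z a : ℕ) : ℕ :=
  I 1 / ∑ σ ∈ Finset.range (I 1), (1 - conflicts k I z a σ)

/-- The weighted number of neighbours of `b` and their letters without conflict that project to
`τ`. -/
def support (k : ℕ) (I : ℕ → ℕ) (z b τ : ℕ) : ℕ :=
  ∑ a ∈ Finset.range (I 0), adj I a b * (weight k I z a *
    ∑ σ ∈ Finset.range (I 1), (1 - conflicts k I z a σ) * eqInd (prj I a b σ) τ)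

/-- The letter at `b` with the largest support. -/
def bestRight (k : ℕ) (I : ℕ → ℕ) (z b : ℕ) : ℕ := argmax (I 1) (support k I z b)

/-- The total support of the code `z`. -/
def score (k : ℕ) (I : ℕ → ℕ) (z : ℕ) : ℕ :=
  ∑ b ∈ Finset.range (I 0), support k I z b (bestRight k I z b)

/-- The best code. -/
def bestCode (k : ℕ) (I : ℕ → ℕ) : ℕ := argmax ((I 0 * I 1) ^ k) (score k I)

/-- The letter of the right vertex `b`. -/
def right (k : ℕ) (I : ℕ → ℕ) (b : ℕ) : ℕ := bestRight k I (bestCode k I) b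

/-- The number of edges at `a` that are satisfied if `a` has the letter `σ`. -/
def agreement (k : ℕ) (I : ℕ → ℕ) (a σ : ℕ) : ℕ :=
  ∑ b ∈ Finset.range (I 0), adj I a b * eqInd (prj I a b σ) (right k I b)

/-- The letter of the left vertex `a`. -/
def left (k : ℕ) (I : ℕ → ℕ) (a : ℕ) : ℕ := argmax (I 1) (agreement k I a)

/-- The output: the letters of the left vertices, then those of the right vertices. -/
def output (k : ℕ) (I : ℕ → ℕ) (j : ℕ) : ℕ :=
  (1 - (1 - (I 0 - j))) * left k I j + (1 - (I 0 - j)) * right k I (j - I 0)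

lemma output_left (k : ℕ) (I : ℕ → ℕ) {j : ℕ} (hj : j < I 0) : output k I j = left k I j := by
  simp [output, show 1 - (I 0 - j) = 0 by omega]

lemma output_right (k : ℕ) (I : ℕ → ℕ) (j : ℕ) : output k I (I 0 + j) = right k I j := by
  simp [output]

/-- The algorithm that tries all codes for `k` pairs of a left vertex and a letter. -/
noncomputable def alg (k : ℕ) : ProjectionGameAlgorithm := fun _ q _ G =>
  have h : 0 < G.input 1 := (NeZero.pos q).trans_eq G.input_one.symm
  Sum.elim (fun a => ⟨left k G.input a, (argmax_spec h _).1.trans_eq G.input_one⟩)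
    (fun b => ⟨right k G.input b, (argmax_spec h _).1.trans_eq G.input_one⟩)

/-! ### The algorithm as a bounded-sum term, for fixed `k` -/

section Expressible

variable {X : Type} {κ : X → (ℕ → ℕ) × (ℕ → ℕ)} {a b σ z x y : X → ℕ}

open RAM.Expressible

lemma expressible_size : Expressible κ fun x => (κ x).1 0 := (const 0).inp

lemma expressible_alphabet : Expressible κ fun x => (κ x).1 1 := (const 1).inp

lemma expressible_adj (ha : Expressible κ a) (hb : Expressible κ b) :
    Expressible κ fun x => adj (κ x).1 (a x) (b x) :=
  ((const 2).add (hb.add (expressible_size.mul ha))).inp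

lemma expressible_prj (ha : Expressible κ a) (hb : Expressible κ b) (hσ : Expressible κ σ) :
    Expressible κ fun x => prj (κ x).1 (a x) (b x) (σ x) :=
  (((const 2).add (expressible_size.mul expressible_size)).add
    (hσ.add (expressible_alphabet.mul (hb.add (expressible_size.mul ha))))).inp

lemma expressible_eqInd (hx : Expressible κ x) (hy : Expressible κ y) :
    Expressible κ fun w => eqInd (x w) (y w) :=
  (const 1).sub ((hx.sub hy).add (hy.sub hx))

lemma expressible_digit (hz : Expressible κ z) (i : ℕ) :
    Expressible κ fun x => digit (κ x).1 (z x) i :=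
  have h := expressible_size.mul expressible_alphabet
  (hz.div (h.pow_const i)).mod h

lemma expressible_conflicts (k : ℕ) (hz : Expressible κ z) (ha : Expressible κ a)
    (hσ : Expressible κ σ) :
    Expressible κ fun x => conflicts k (κ x).1 (z x) (a x) (σ x) := by
  refine sum_const k fun i => expressible_size.sum ?_
  have hd := (expressible_digit hz i).weaken
  have hv := hd.div expressible_alphabet
  exact (expressible_adj hv bvar).mul ((expressible_adj ha.weaken bvar).mul
    ((const 1).sub (expressible_eqInd (expressible_prj ha.weaken bvar hσ.weaken)
      (expressible_prj hv bvar (hd.mod expressible_alphabet)))))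

lemma expressible_weight (k : ℕ) (hz : Expressible κ z) (ha : Expressible κ a) :
    Expressible κ fun x => weight k (κ x).1 (z x) (a x) :=
  expressible_alphabet.div (expressible_alphabet.sum
    ((const 1).sub (expressible_conflicts k hz.weaken ha.weaken bvar)))

lemma expressible_support (k : ℕ) (hz : Expressible κ z) (hb : Expressible κ b)
    (hσ : Expressible κ σ) :
    Expressible κ fun x => support k (κ x).1 (z x) (b x) (σ x) :=
  expressible_size.sum ((expressible_adj bvar hb.weaken).mul
    ((expressible_weight k hz.weaken bvar).mul (expressible_alphabet.sum
      (((const 1).sub (expressible_conflicts k hz.weaken.weaken bvar.weaken bvar)).mul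
        (expressible_eqInd (expressible_prj bvar.weaken hb.weaken.weaken bvar)
          hσ.weaken.weaken)))))

lemma expressible_bestRight (k : ℕ) (hz : Expressible κ z) (hb : Expressible κ b) :
    Expressible κ fun x => bestRight k (κ x).1 (z x) (b x) :=
  expressible_alphabet.argmax (expressible_support k hz.weaken hb.weaken bvar)

lemma expressible_score (k : ℕ) (hz : Expressible κ z) :
    Expressible κ fun x => score k (κ x).1 (z x) :=
  expressible_size.sum (expressible_support k hz.weaken bvar
    (expressible_bestRight k hz.weaken bvar))

lemma expressible_bestCode (k : ℕ) : Expressible κ fun x => bestCode k (κ x).1 :=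
  ((expressible_size.mul expressible_alphabet).pow_const k).argmax (expressible_score k bvar)

lemma expressible_right (k : ℕ) (hb : Expressible κ b) :
    Expressible κ fun x => right k (κ x).1 (b x) :=
  expressible_bestRight k (expressible_bestCode k) hb

lemma expressible_agreement (k : ℕ) (ha : Expressible κ a) (hσ : Expressible κ σ) :
    Expressible κ fun x => agreement k (κ x).1 (a x) (σ x) :=
  expressible_size.sum ((expressible_adj ha.weaken bvar).mul
    (expressible_eqInd (expressible_prj ha.weaken bvar hσ.weaken) (expressible_right k bvar)))

lemma expressible_left (k : ℕ) (ha : Expressible κ a) :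
    Expressible κ fun x => left k (κ x).1 (a x) :=
  expressible_alphabet.argmax (expressible_agreement k ha.weaken bvar)

lemma expressible_output (k : ℕ) (ha : Expressible κ a) :
    Expressible κ fun x => output k (κ x).1 (a x) :=
  (((const 1).sub ((const 1).sub (expressible_size.sub ha))).mul (expressible_left k ha)).add
    (((const 1).sub (expressible_size.sub ha)).mul (expressible_right k (ha.sub expressible_size)))

end Expressible

theorem alg_isPolyTime (k : ℕ) : (alg k).IsPolyTime := by
  refine ProjectionGameAlgorithm.isPolyTime_of_expressible _ (output k)
    (expressible_output k Expressible.bvar) (fun m q _ G a => ?_) (fun m q _ G b => ?_)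
  · rw [output_left k _ (a.2.trans_eq G.input_zero.symm)]
    rfl
  · have h := output_right k G.input b
    rw [G.input_zero] at h
    exact h

end SeedSearch

/-! ### Seeds that determine many letters -/

section Seeds

open scoped Classical

variable {A B Q : Type} [Fintype A] [Fintype B] [Fintype Q]

/-- The letters at `a'` that are consistent with the right letters `β` on the common neighbours of
`a'` and the vertices in `S`. -/
noncomputable def candidates (E : Set (A × B)) (f : A → B → Q → ℕ) (β : B → ℕ) (S : Finset A)
    (a' : A) : Finset Q :=
  Finset.univ.filter fun σ => ∀ a ∈ S, ∀ b, (a, b) ∈ E → (a', b) ∈ E → f a' b σ = β b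

/-- The fraction of the candidates at `a'` that project to `β b`. -/
noncomputable def candidateFraction (E : Set (A × B)) (f : A → B → Q → ℕ) (β : B → ℕ)
    (S : Finset A) (a' : A) (b : B) : ℝ :=
  (((candidates E f β S a').filter fun σ => f a' b σ = β b).card : ℝ) /
    (candidates E f β S a').card

/-- The total entropy of the candidates. -/
noncomputable def entropy (E : Set (A × B)) (f : A → B → Q → ℕ) (β : B → ℕ) (S : Finset A) : ℝ :=
  ∑ a', Real.log (candidates E f β S a').card

variable (E : Set (A × B)) (f : A → B → Q → ℕ) (α : A → Q) (β : B → ℕ)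

/-- The planted letter `α a'` is never excluded, so the logarithms and quotients below are
meaningful. -/
lemma candidates_card_pos (hα : ∀ a b, (a, b) ∈ E → f a b (α a) = β b) (S : Finset A) (a' : A) :
    0 < (candidates E f β S a').card :=
  Finset.card_pos.2 ⟨α a', by
    simp only [candidates, Finset.mem_filter, Finset.mem_univ, true_and]
    exact fun _ _ b _ h => hα a' b h⟩

/-- Otherwise every nonempty set of at most `k + 1` vertices could be extended with an entropy drop
of more than `n L / k`. Starting from a singleton, where the entropy is at most `n L`, `k` such
extensions bring it to at most `0`, and one more makes it negative. -/
lemma exists_seed [Nonempty A] (hα : ∀ a b, (a, b) ∈ E → f a b (α a) = β b) {k : ℕ} (hk : 0 < k) :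
    ∃ S : Finset A, S.Nonempty ∧ S.card ≤ k + 1 ∧ ∀ a, entropy E f β S - entropy E f β (insert a S)
      ≤ Fintype.card A * (Real.log (Fintype.card Q) / k) := by
  set L := Real.log (Fintype.card Q) with hL
  set n : ℝ := ((Fintype.card A : ℕ) : ℝ) with hn
  have hL0 : 0 ≤ L := Real.log_natCast_nonneg _
  have hpos : ∀ S, 0 ≤ entropy E f β S := fun S =>
    Finset.sum_nonneg fun a _ => Real.log_natCast_nonneg _
  by_contra! hcon
  have key : ∀ i ≤ k, ∃ S : Finset A, S.Nonempty ∧ S.card ≤ i + 1 ∧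
      entropy E f β S ≤ n * L - i * (n * (L / k)) := by
    intro i
    induction i with
    | zero =>
      intro _
      obtain ⟨a⟩ := ‹Nonempty A›
      refine ⟨{a}, Finset.singleton_nonempty a, by simp, ?_⟩
      have : entropy E f β {a} ≤ ∑ _a' : A, L := by
        refine Finset.sum_le_sum fun a' _ => Real.log_le_log ?_ ?_
        · exact_mod_cast candidates_card_pos E f α β hα {a} a'
        · exact_mod_cast Finset.card_le_univ _
      simpa [hn] using this
    | succ i ih =>
      intro hi
      obtain ⟨S, hS, hcard, hle⟩ := ih (by omega)
      obtain ⟨a, ha⟩ := hcon S hS (by omega)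
      refine ⟨insert a S, Finset.insert_nonempty _ _, (Finset.card_insert_le _ _).trans (by omega),
        ?_⟩
      push_cast
      linarith
  obtain ⟨S, hS, hcard, hle⟩ := key k le_rfl
  obtain ⟨a, ha⟩ := hcon S hS hcard
  have hk' : (k : ℝ) ≠ 0 := by positivity
  have h0 : n * L - k * (n * (L / k)) = 0 := by
    field_simp
    ring
  have h1 : 0 ≤ n * (L / k) := by positivity
  linarith [hpos (insert a S)]

/-- Both sides bound a sum over paths `a`, `b`, `a'`: each pair `a`, `a'` has at least `c` middle
vertices `b`, and each edge `(a', b)` extends to at most `D` vertices `a`. -/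
lemma le_sum_candidateFraction (hα : ∀ a b, (a, b) ∈ E → f a b (α a) = β b) {c D t : ℝ}
    (hc : ∀ a a', c ≤ (Finset.univ.filter fun b => (a, b) ∈ E ∧ (a', b) ∈ E).card)
    (hD : ∀ b, (Finset.univ.filter fun a => (a, b) ∈ E).card ≤ D) (hc0 : 0 ≤ c)
    {S : Finset A} (hS : ∀ a, entropy E f β S - entropy E f β (insert a S) ≤ Fintype.card A * t) :
    c * (Fintype.card A) ^ 2 * Real.exp (-t) ≤
      D * ∑ a', ∑ b, if (a', b) ∈ E then candidateFraction E f β S a' b else 0 := by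
  set n : ℝ := ((Fintype.card A : ℕ) : ℝ) with hn
  let ratio : A → A → ℝ := fun a a' =>
    ((candidates E f β (insert a S) a').card : ℝ) / (candidates E f β S a').card
  have hpos : ∀ S a', (0 : ℝ) < (candidates E f β S a').card := fun S a' => by
    exact_mod_cast candidates_card_pos E f α β hα S a'
  have hratio : ∀ a a', 0 < ratio a a' := fun a a' => div_pos (hpos _ _) (hpos _ _)
  have hrow : ∀ a, n * Real.exp (-t) ≤ ∑ a', ratio a a' := by
    intro a
    -- The tangent to the exponential at `0`, evaluated at `log ratio + t`; summed over `a'`, this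
    -- replaces the inequality of arithmetic and geometric means.
    have h1 : ∀ a', Real.exp (-t) * (1 + Real.log (ratio a a') + t) ≤ ratio a a' := by
      intro a'
      have h2 := Real.add_one_le_exp (Real.log (ratio a a') + t)
      rw [Real.exp_add, Real.exp_log (hratio a a')] at h2
      have h3 := mul_le_mul_of_nonneg_left h2 (Real.exp_pos (-t)).le
      have h4 : Real.exp (-t) * (ratio a a' * Real.exp t) = ratio a a' := by
        rw [mul_left_comm, ← Real.exp_add]
        simp
      rw [h4] at h3
      linarith
    refine le_trans ?_ (Finset.sum_le_sum fun a' _ => h1 a')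
    rw [← Finset.mul_sum, mul_comm]
    refine mul_le_mul_of_nonneg_left ?_ (Real.exp_pos _).le
    have h5 : ∑ a', Real.log (ratio a a') = entropy E f β (insert a S) - entropy E f β S := by
      rw [entropy, entropy, ← Finset.sum_sub_distrib]
      exact Finset.sum_congr rfl fun a' _ => Real.log_div (hpos _ _).ne' (hpos _ _).ne'
    simp only [Finset.sum_add_distrib, Finset.sum_const, Finset.card_univ, nsmul_eq_mul, mul_one,
      h5, ← hn]
    linarith [hS a]
  -- A candidate that survives the seed `a` has the correct projection at every common neighbour
  -- `b`.
  have hfrac : ∀ a a' b, (a, b) ∈ E → (a', b) ∈ E →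
      ratio a a' ≤ candidateFraction E f β S a' b := by
    intro a a' b h h'
    refine div_le_div_of_nonneg_right ?_ (hpos _ _).le
    refine Nat.cast_le.2 (Finset.card_le_card fun σ hσ => ?_)
    simp only [candidates, Finset.mem_filter, Finset.mem_univ, true_and, Finset.mem_insert,
      forall_eq_or_imp] at hσ ⊢
    exact ⟨hσ.2, hσ.1 b h h'⟩
  have hpair : ∀ a a', c * ratio a a' ≤
      ∑ b, if (a, b) ∈ E ∧ (a', b) ∈ E then candidateFraction E f β S a' b else 0 := by
    intro a a'
    rw [← Finset.sum_filter]
    refine (mul_le_mul_of_nonneg_right (hc a a') (hratio a a').le).trans ?_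
    rw [← nsmul_eq_mul]
    refine Finset.card_nsmul_le_sum _ _ _ fun b hb => ?_
    simp only [Finset.mem_filter, Finset.mem_univ, true_and] at hb
    exact hfrac a a' b hb.1 hb.2
  calc c * n ^ 2 * Real.exp (-t) = c * ∑ _a : A, n * Real.exp (-t) := by
        simp only [Finset.sum_const, Finset.card_univ, nsmul_eq_mul, ← hn]
        ring
    _ ≤ c * ∑ a, ∑ a', ratio a a' :=
        mul_le_mul_of_nonneg_left (Finset.sum_le_sum fun a _ => hrow a) hc0
    _ = ∑ a, ∑ a', c * ratio a a' := by simp only [Finset.mul_sum]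
    _ ≤ ∑ a, ∑ a', ∑ b,
          if (a, b) ∈ E ∧ (a', b) ∈ E then candidateFraction E f β S a' b else 0 :=
        Finset.sum_le_sum fun a _ => Finset.sum_le_sum fun a' _ => hpair a a'
    _ = ∑ a', ∑ b, ∑ a,
          if (a, b) ∈ E ∧ (a', b) ∈ E then candidateFraction E f β S a' b else 0 := by
        rw [Finset.sum_comm]
        exact Finset.sum_congr rfl fun a' _ => Finset.sum_comm
    _ ≤ ∑ a', ∑ b, D * if (a', b) ∈ E then candidateFraction E f β S a' b else 0 := by
        refine Finset.sum_le_sum fun a' _ => Finset.sum_le_sum fun b _ => ?_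
        by_cases h : (a', b) ∈ E
        · simp only [h, and_true, if_true]
          rw [← Finset.sum_filter, Finset.sum_const, nsmul_eq_mul]
          exact mul_le_mul_of_nonneg_right (hD b) (by unfold candidateFraction; positivity)
        · simp [h]
    _ = _ := by simp only [Finset.mul_sum]

end Seeds

/-! ### Analysis of the algorithm -/

namespace SeedSearch

/-- For the best code, exchanging sums turns the score into a weighted sum of agreements over the
candidates at each `a`. The weight times the number of candidates is at most `q`, and the left
letter maximizes the agreement. -/
lemma score_le_agreement (k : ℕ) (I : ℕ → ℕ) (hq : 0 < I 1) {z : ℕ}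
    (hz : z < (I 0 * I 1) ^ k) :
    score k I z ≤ I 1 * ∑ a ∈ Finset.range (I 0), agreement k I a (left k I a) := by
  refine ((RAM.argmax_spec (by omega) (score k I)).2 z hz).trans ?_
  change score k I (bestCode k I) ≤ _
  set y := bestCode k I with hy
  simp only [score, support]
  rw [Finset.sum_comm, Finset.mul_sum]
  refine Finset.sum_le_sum fun a _ => ?_
  have hmax : ∀ σ ∈ Finset.range (I 1), (1 - conflicts k I y a σ) * agreement k I a σ ≤
      (1 - conflicts k I y a σ) * agreement k I a (left k I a) := fun σ hσ =>
    Nat.mul_le_mul_left _ ((RAM.argmax_spec hq (agreement k I a)).2 σ (Finset.mem_range.1 hσ))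
  calc ∑ b ∈ Finset.range (I 0), adj I a b * (weight k I y a * ∑ σ ∈ Finset.range (I 1),
        (1 - conflicts k I y a σ) * eqInd (prj I a b σ) (bestRight k I y b))
      = weight k I y a * ∑ σ ∈ Finset.range (I 1),
          (1 - conflicts k I y a σ) * agreement k I a σ := by
        simp only [agreement, right, ← hy, Finset.mul_sum]
        rw [Finset.sum_comm]
        refine Finset.sum_congr rfl fun _ _ => Finset.sum_congr rfl fun _ _ => by ring
    _ ≤ weight k I y a * ∑ σ ∈ Finset.range (I 1),
          (1 - conflicts k I y a σ) * agreement k I a (left k I a) :=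
        Nat.mul_le_mul_left _ (Finset.sum_le_sum hmax)
    _ = (weight k I y a * ∑ σ ∈ Finset.range (I 1), (1 - conflicts k I y a σ)) *
          agreement k I a (left k I a) := by
        rw [← Finset.sum_mul, mul_assoc]
    _ ≤ I 1 * agreement k I a (left k I a) :=
        Nat.mul_le_mul_right _ (Nat.div_mul_le_self _ _)

open scoped Classical in
lemma ncard_eq_sum {A B : Type} [Fintype A] [Fintype B] (s : Set (A × B)) :
    s.ncard = ∑ a, ∑ b, if (a, b) ∈ s then 1 else 0 := by
  rw [Set.ncard_eq_toFinset_card', ← Fintype.sum_prod_type' (f := fun a b => if (a, b) ∈ s then 1 else 0)]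
  simp only [Prod.mk.eta, Finset.sum_boole, Nat.cast_id]
  congr 1
  ext x
  simp

section Game

open scoped Classical

variable {m q : ℕ} (G : ProjectionGame (Fin m) (Fin m) q)

/-- The projections of a game, extended by `0` to pairs that are not edges. -/
noncomputable def extProj (a b : Fin m) (σ : Fin q) : ℕ :=
  if h : (a, b) ∈ G.edges then (G.proj ⟨_, h⟩ σ : ℕ) else 0

lemma adj_input (a b : Fin m) : adj G.input a b = if (a, b) ∈ G.edges then 1 else 0 := by
  rw [adj, G.input_zero, G.input_adj]

lemma prj_input (a b : Fin m) (σ : Fin q) : prj G.input a b σ = extProj G a b σ := by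
  rw [prj, G.input_zero, G.input_one, G.input_proj, extProj]

lemma ncard_satisfied_alg [NeZero q] (k : ℕ) :
    (G.satisfied (alg k m q G)).ncard =
      ∑ a ∈ Finset.range m, agreement k G.input a (left k G.input a) := by
  rw [ncard_eq_sum, Finset.sum_range]
  refine Finset.sum_congr rfl fun a _ => ?_
  rw [agreement, G.input_zero, Finset.sum_range]
  refine Finset.sum_congr rfl fun b _ => ?_
  have h1 : left k G.input a = (alg k m q G (Sum.inl a) : ℕ) := rfl
  have h2 : right k G.input b = (alg k m q G (Sum.inr b) : ℕ) := rfl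
  rw [adj_input, h1, h2, prj_input, eqInd_eq, extProj]
  by_cases h : (a, b) ∈ G.edges
  · simp [ProjectionGame.satisfied, h, Fin.ext_iff]
  · simp [ProjectionGame.satisfied, h]

end Game

end SeedSearch

namespace SeedSearch

section Game

open scoped Classical

variable {m q : ℕ} (G : ProjectionGame (Fin m) (Fin m) q)

/-- The code of the pairs `(s i, α (s i))`. -/
def code {k : ℕ} (α : Fin m → Fin q) (s : Fin k → Fin m) : Fin ((m * q) ^ k) :=
  finFunctionFinEquiv fun i => finProdFinEquiv (s i, α (s i))

lemma digit_code {k : ℕ} (α : Fin m → Fin q) (s : Fin k → Fin m) (i : Fin k) :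
    digit G.input (code α s) i = α (s i) + q * s i := by
  have h := congrArg Fin.val (congrFun (finFunctionFinEquiv.symm_apply_apply
    fun i => finProdFinEquiv (s i, α (s i))) i)
  rw [finProdFinEquiv_apply_val] at h
  rw [digit, G.input_zero, G.input_one, ← h]
  rfl

lemma digit_code_div {k : ℕ} (α : Fin m → Fin q) (s : Fin k → Fin m) (i : Fin k) :
    digit G.input (code α s) i / q = s i := by
  have h := (α (s i)).2
  rw [digit_code, Nat.add_mul_div_left _ _ (by omega), Nat.div_eq_of_lt h, zero_add]

lemma digit_code_mod {k : ℕ} (α : Fin m → Fin q) (s : Fin k → Fin m) (i : Fin k) :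
    digit G.input (code α s) i % q = α (s i) := by
  rw [digit_code, Nat.add_mul_mod_self_left, Nat.mod_eq_of_lt (α (s i)).2]

variable {α : Fin m → Fin q} {β : Fin m → ℕ}

/-- Seeds with their planted letters project to `β b` at each neighbour `b`, so freedom from
conflict is membership in `candidates`. -/
lemma one_sub_conflicts (hα : ∀ a b, (a, b) ∈ G.edges → extProj G a b (α a) = β b) {k : ℕ}
    (s : Fin k → Fin m) (a : Fin m) (σ : Fin q) :
    1 - conflicts k G.input (code α s) a σ =
      if σ ∈ candidates G.edges (extProj G) β (Finset.univ.image s) a then 1 else 0 := by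
  have h : conflicts k G.input (code α s) a σ = 0 ↔
      σ ∈ candidates G.edges (extProj G) β (Finset.univ.image s) a := by
    rw [conflicts, Finset.sum_range, Finset.sum_eq_zero_iff]
    simp only [candidates, Finset.mem_filter, Finset.mem_univ, true_and, Finset.mem_image,
      forall_exists_index, forall_apply_eq_imp_iff, forall_true_left]
    refine forall_congr' fun i => ?_
    rw [G.input_zero, G.input_one, Finset.sum_range, Finset.sum_eq_zero_iff]
    simp only [Finset.mem_univ, forall_true_left]
    refine forall_congr' fun b => ?_
    rw [digit_code_div, digit_code_mod, adj_input, adj_input, prj_input, prj_input, eqInd_eq]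
    by_cases h₁ : (s i, b) ∈ G.edges
    · rw [hα _ _ h₁]
      by_cases h₂ : (a, b) ∈ G.edges
      · by_cases h₃ : extProj G a b σ = β b <;> simp [h₁, h₂, h₃]
      · simp [h₂]
    · simp [h₁]
  split_ifs with h'
  · rw [h.2 h']
  · have := mt h.1 h'
    omega

lemma weight_code (hα : ∀ a b, (a, b) ∈ G.edges → extProj G a b (α a) = β b) {k : ℕ}
    (s : Fin k → Fin m) (a : Fin m) :
    weight k G.input (code α s) a =
      q / (candidates G.edges (extProj G) β (Finset.univ.image s) a).card := by
  rw [weight, G.input_one, Finset.sum_range]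
  simp only [one_sub_conflicts G hα, Finset.sum_boole, Nat.cast_id, Finset.filter_univ_mem]

lemma support_code (hα : ∀ a b, (a, b) ∈ G.edges → extProj G a b (α a) = β b) {k : ℕ}
    (s : Fin k → Fin m) (b : Fin m) :
    support k G.input (code α s) b (β b) = ∑ a, if (a, b) ∈ G.edges then
      q / (candidates G.edges (extProj G) β (Finset.univ.image s) a).card *
        ((candidates G.edges (extProj G) β (Finset.univ.image s) a).filter
          fun σ => extProj G a b σ = β b).card else 0 := by
  rw [support, G.input_zero, G.input_one, Finset.sum_range]
  refine Finset.sum_congr rfl fun a _ => ?_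
  rw [Finset.sum_range, weight_code G hα, adj_input]
  simp only [one_sub_conflicts G hα, prj_input, eqInd_eq, ite_mul, one_mul, zero_mul]
  congr 2
  rw [← Finset.sum_filter, Finset.filter_univ_mem, Finset.sum_boole, Nat.cast_id]

/-- The planted seed code is among those tried, and at each `b` the letter `β b` competes for the
largest support. So the best score is at least the planted support, which `score_le_agreement`
converts into satisfied edges. -/
lemma sum_candidateFraction_le [NeZero q]
    (hα : ∀ a b, (a, b) ∈ G.edges → extProj G a b (α a) = β b) (hβ : ∀ b, β b < q) {k : ℕ}
    (s : Fin k → Fin m) :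
    (∑ a, ∑ b, if (a, b) ∈ G.edges then
      candidateFraction G.edges (extProj G) β (Finset.univ.image s) a b else 0) ≤
      2 * ((G.satisfied (alg k m q G)).ncard : ℝ) := by
  have hq : 0 < q := NeZero.pos q
  set S := Finset.univ.image s
  have h₁ := score_le_agreement k G.input (hq.trans_eq G.input_one.symm) (z := code α s)
    ((code α s).2.trans_eq (by rw [G.input_zero, G.input_one]))
  rw [G.input_zero, G.input_one, ← ncard_satisfied_alg] at h₁
  have h₂ : ∑ b : Fin m, support k G.input (code α s) b (β b) ≤ score k G.input (code α s) := by
    rw [score, G.input_zero, Finset.sum_range]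
    refine Finset.sum_le_sum fun b _ => (RAM.argmax_spec (hq.trans_eq G.input_one.symm) _).2 _ ?_
    exact (hβ b).trans_eq G.input_one.symm
  simp only [support_code G hα] at h₂
  rw [Finset.sum_comm] at h₂
  have h₃ : ((∑ a, ∑ b, if (a, b) ∈ G.edges then
      q / (candidates G.edges (extProj G) β S a).card *
        ((candidates G.edges (extProj G) β S a).filter
          fun σ => extProj G a b σ = β b).card else 0 : ℕ) : ℝ) ≤
      ((q * (G.satisfied (alg k m q G)).ncard : ℕ) : ℝ) := Nat.cast_le.2 (h₂.trans h₁)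
  push_cast at h₃
  have h₄ : (q : ℝ) * (∑ a, ∑ b, if (a, b) ∈ G.edges then
      candidateFraction G.edges (extProj G) β S a b else 0) ≤
      2 * ((q : ℝ) * (G.satisfied (alg k m q G)).ncard) := by
    refine le_trans ?_ (mul_le_mul_of_nonneg_left h₃ zero_le_two)
    simp only [Finset.mul_sum]
    refine Finset.sum_le_sum fun a _ => Finset.sum_le_sum fun b _ => ?_
    split_ifs
    · have hc := candidates_card_pos G.edges (extProj G) α β hα S a
      have hcq : (candidates G.edges (extProj G) β S a).card ≤ q :=
        (Finset.card_le_univ _).trans_eq (Fintype.card_fin q)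
      rw [candidateFraction]
      set r := (candidates G.edges (extProj G) β S a).card
      set w := ((candidates G.edges (extProj G) β S a).filter
          fun σ => extProj G a b σ = β b).card
      have hr : (0 : ℝ) < r := by exact_mod_cast hc
      -- Since `r ≤ q`, the rounded weight `q / r` is at least `1`, so rounding down loses at most a
      -- factor `2`.
      have hdiv : (q : ℝ) ≤ 2 * (r * (q / r : ℕ)) := by
        have h5 := Nat.div_add_mod q r
        have h6 := Nat.mod_lt q hc
        have h7 : 1 ≤ q / r := Nat.div_pos hcq hc
        have h8 : r ≤ r * (q / r) := Nat.le_mul_of_pos_right r h7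
        exact_mod_cast (by omega : q ≤ 2 * (r * (q / r)))
      rw [mul_div_assoc', div_le_iff₀ hr]
      have := mul_le_mul_of_nonneg_right hdiv (Nat.cast_nonneg (α := ℝ) w)
      linarith
    · simp
  have hq' : (0 : ℝ) < q := by exact_mod_cast hq
  refine le_of_mul_le_mul_left (h₄.trans_eq ?_) hq'
  ring

omit G in
-- Repeating an element fills up the tuple, so codes of fixed length cover all smaller nonempty seed
-- sets.
lemma exists_image_eq {k : ℕ} {S : Finset (Fin m)} (hS : S.Nonempty) (hcard : S.card ≤ k) :
    ∃ s : Fin k → Fin m, Finset.univ.image s = S := by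
  obtain ⟨a, ha⟩ := hS
  obtain ⟨e⟩ := Function.Embedding.nonempty_of_card_le (α := S) (β := Fin k) (by simpa using hcard)
  have : Nonempty S := ⟨⟨a, ha⟩⟩
  refine ⟨fun i => ((Function.invFun e i : S) : Fin m), ?_⟩
  ext x
  simp only [Finset.mem_image, Finset.mem_univ, true_and]
  constructor
  · rintro ⟨i, rfl⟩
    exact (Function.invFun e i : S).2
  · intro hx
    exact ⟨e ⟨x, hx⟩, by rw [Function.leftInverse_invFun e.injective]⟩

theorem le_value_alg [NeZero q] (hm : 0 < m) (hG : G.Satisfiable) {k : ℕ} (hk : 0 < k) {c D : ℝ}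
    (hc : 0 < c) (hE : HasDegreeBounds G.edges c D) :
    c * m / (2 * D ^ 2) * (q : ℝ) ^ (-(1 / k : ℝ)) ≤ G.value (alg (k + 1) m q G) := by
  have : Nonempty (Fin m) := ⟨⟨0, hm⟩⟩
  have hq : 0 < q := NeZero.pos q
  have hq' : (0 : ℝ) < q := by exact_mod_cast hq
  have hm' : (0 : ℝ) < m := by exact_mod_cast hm
  obtain ⟨φ, hφ⟩ := hG
  have hα : ∀ a b, (a, b) ∈ G.edges → extProj G a b (φ (Sum.inl a)) = (φ (Sum.inr b) : ℕ) := by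
    intro a b h
    obtain ⟨h', heq⟩ : (a, b) ∈ G.satisfied φ := hφ ▸ h
    rw [extProj, dif_pos h, heq]
  obtain ⟨S, hS, hcard, hS'⟩ := exists_seed G.edges (extProj G) (fun a => φ (Sum.inl a))
    (fun b => (φ (Sum.inr b) : ℕ)) hα hk
  obtain ⟨s, rfl⟩ := exists_image_eq hS hcard
  have h₁ := le_sum_candidateFraction G.edges (extProj G) (fun a => φ (Sum.inl a))
    (fun b => (φ (Sum.inr b) : ℕ)) hα hE.1 hE.2 hc.le hS'
  have h₂ := sum_candidateFraction_le G hα (fun b => (φ (Sum.inr b)).2) s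
  have hexp : Real.exp (-(Real.log (Fintype.card (Fin q)) / k)) = (q : ℝ) ^ (-(1 / k : ℝ)) := by
    rw [Real.rpow_def_of_pos hq', Fintype.card_fin]
    ring_nf
  rw [hexp, Fintype.card_fin] at h₁
  set N := (q : ℝ) ^ (-(1 / k : ℝ)) with hN
  set M := ((G.satisfied (alg (k + 1) m q G)).ncard : ℝ) with hM
  have hpos : 0 < N := Real.rpow_pos_of_pos hq' _
  have hedges : (G.edges.ncard : ℝ) ≤ m * D := by
    rw [ncard_eq_sum, Finset.sum_comm]
    push_cast
    refine (Finset.sum_le_card_nsmul _ _ D fun b _ => ?_).trans_eq (by simp)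
    simpa using hE.2 b
  obtain ⟨a⟩ := this
  -- The diagonal case of the common-neighbour bound yields an edge, whence the value has a nonzero
  -- denominator and `D > 0`.
  obtain ⟨b, hb⟩ : (Finset.univ.filter fun b => (a, b) ∈ G.edges ∧ (a, b) ∈ G.edges).Nonempty := by
    rw [← Finset.card_pos]
    exact_mod_cast hc.trans_le (hE.1 a a)
  have hab : (a, b) ∈ G.edges := (Finset.mem_filter.1 hb).2.1
  have hepos : (0 : ℝ) < G.edges.ncard := by
    exact_mod_cast (Set.ncard_pos (Set.toFinite _)).2 ⟨_, hab⟩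
  have hD : 0 < D :=
    (pos_iff_pos_of_mul_pos (hepos.trans_le hedges)).1 hm'
  have h₃ : c * m ^ 2 * N ≤ D * (2 * M) := h₁.trans (mul_le_mul_of_nonneg_left h₂ hD.le)
  rw [ProjectionGame.value, le_div_iff₀ hepos]
  calc c * m / (2 * D ^ 2) * N * G.edges.ncard ≤ c * m / (2 * D ^ 2) * N * (m * D) :=
        mul_le_mul_of_nonneg_left hedges (by positivity)
    _ = c * m ^ 2 * N / (2 * D) := by
        field_simp
    _ ≤ M := by
        rw [div_le_iff₀ (by positivity)]
        linarith

end Game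

end SeedSearch

/-! ### The main theorem -/

theorem theorem3 (γ : ℝ) (hγ : 0 < γ) :
    ∃ alg : ProjectionGameAlgorithm, alg.IsPolyTime ∧
      ∃ (K : ℝ) (ε : ℕ → ℝ), 0 < K ∧ Tendsto ε atTop (𝓝 0) ∧
        ∀ (m : ℕ) (p : unitInterval),
          10 * √(Real.log (2 * m : ℝ) / (2 * m : ℝ)) ≤ (p : ℝ) →
          1 - ε m ≤ (randomBipartite m p).real
            {E | ∀ (q : ℕ) [NeZero q] (G : ProjectionGame (Fin m) (Fin m) q),
              G.edges = E → G.Satisfiable →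
              K * (2 * m * q : ℝ) ^ (-γ) ≤ G.value (alg m q G)} := by
  obtain ⟨k, hk⟩ := exists_nat_ge (1 / γ)
  have hk0 : 0 < k := by
    have : (0 : ℝ) < k := (one_div_pos.2 hγ).trans_le hk
    exact_mod_cast this
  have hkγ : 1 / (k : ℝ) ≤ γ := (one_div_le (by positivity) hγ).2 hk
  -- The error `2 / (m + 1)` dominates `1 / m` for `m ≥ 2` and makes the claim trivial for `m ≤ 1`.
  refine ⟨SeedSearch.alg (k + 1), SeedSearch.alg_isPolyTime _, 1 / 128,
    fun m => 2 / ((m : ℝ) + 1), by norm_num, ?_, fun m p hp => ?_⟩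
  · have h := (tendsto_const_div_atTop_nhds_zero_nat (2 : ℝ)).comp (tendsto_add_atTop_nat 1)
    refine h.congr fun m => ?_
    simp
  · have : IsProbabilityMeasure (randomBipartite m p) := by
      rw [randomBipartite]
      infer_instance
    by_cases hm : m ≤ 1
    · refine le_trans ?_ measureReal_nonneg
      have : (m : ℝ) ≤ 1 := by exact_mod_cast hm
      rw [sub_nonpos, le_div_iff₀ (by positivity)]
      linarith
    have hm2 : 2 ≤ m := by omega
    have hm' : (2 : ℝ) ≤ m := by exact_mod_cast hm2
    have hlog : 0 < Real.log (2 * m : ℝ) := Real.log_pos (by linarith)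
    have hp0 : (0 : ℝ) < p := lt_of_lt_of_le (by positivity) hp
    have hε : 1 / (m : ℝ) ≤ 2 / ((m : ℝ) + 1) := by
      rw [div_le_div_iff₀ (by linarith) (by linarith)]
      linarith
    refine le_trans (by linarith) ((randomBipartite_hasDegreeBounds m hm2 p hp).trans
      (measureReal_mono fun E hE q _ G hGE hG => ?_))
    subst hGE
    have hq : (1 : ℝ) ≤ q := by exact_mod_cast NeZero.one_le
    have hN : (q : ℝ) ≤ 2 * m * q := by nlinarith
    refine le_trans ?_ (SeedSearch.le_value_alg G (by omega) hG hk0 (by positivity) hE)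
    -- Both `p` and `m` cancel, so the constant is independent of the density.
    have hK : (p : ℝ) ^ 2 * m / 4 * m / (2 * (4 * (p * m)) ^ 2) = 1 / 128 := by
      field_simp
      norm_num
    rw [hK]
    refine mul_le_mul_of_nonneg_left ?_ (by norm_num)
    calc (2 * m * q : ℝ) ^ (-γ) ≤ (q : ℝ) ^ (-γ) :=
          Real.rpow_le_rpow_of_nonpos (by linarith) hN (by linarith)
      _ ≤ (q : ℝ) ^ (-(1 / k : ℝ)) := Real.rpow_le_rpow_of_exponent_le hq (by linarith)
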